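/- All matrices are binary (entries $0$ and $1$). A matrix has the \emph{circular-ones property} (for rows) if its columns can be arranged circularly so that the $1$'s in each row occur consecutively in the arrangement. A matrix $M$ \emph{contains} a matrix $F$ \emph{as a configuration} if some submatrix of $M$ equals $F$ up to permutations of rows and of columns. A matrix $M$ is a \emph{minimal forbidden submatrix for the circular-ones property} if $M$ does not have the circular-ones property but every submatrix of $M$ different from $M$ has it. For a matrix $M$, let $\overline M$ be the matrix obtained from $M$ by interchanging $0$'s and $1$'s, and let $M^*$ be the matrix obtained from $M$ by adding one last column consisting entirely of $0$'s. If $M$ has $k$ rows and $a=a_1\ldots a_k$ is a binary sequence, let $a\odot M$ be the matrix obtained from $M$ by complementing (interchanging $0$'s and $1$'s in) each row $i$ with $a_i=1$. A \emph{binary bracelet} of length $k$ is a binary sequence that is lexicographically smallest in its equivalence class under shifts $a_1a_2\ldots a_k\mapsto a_2\ldots a_ka_1$ and reversals $a_1\ldots a_k\mapsto a_k\ldots a_1$. For $k\ge 4$ let $A_k$ be the set of binary bracelets of length $k$, and let $A_3=\{000,111\}$. For $k\ge 3$ let $M_{\mathrm I}(k)$ be the $k\times k$ matrix whose row $i$ has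 $1$'s exactly in columns $i$ and $i+1$ (column $k+1$ meaning column $1$). Let \[ M_{\mathrm{IV}}=\begin{pmatrix}1&1&0&0&0&0\\0&0&1&1&0&0\\0&0&0&0&1&1\\0&1&0&1&0&1\end{pmatrix},\qquad M_{\mathrm V}=\begin{pmatrix}1&1&0&0&0\\1&1&1&1&0\\0&0&1&1&0\\1&0&0&1&1\end{pmatrix}, \] and \[ \mathrm{ForbRow}=\{a\odot M_{\mathrm I}(k)^*: k\ge 3,\ a\in A_k\}\cup\{M_{\mathrm{IV}},\overline{M_{\mathrm{IV}}},M_{\mathrm V}^*,\overline{M_{\mathrm V}^*}\}. \] \textbf{Theorem.} A matrix $M$ has the circular-ones property if and only if $M$ contains no matrix in the set $\mathrm{ForbRow}$ as a configuration. Moreover, $\mathrm{ForbRow}$ is a minimal set having this property (that is, no proper subset $S$ of $\mathrm{ForbRow}$ is such that the matrices with the circular-ones property are exactly those containing no member of $S$ as a configuration), and every matrix in $\mathrm{ForbRow}$ is a minimal forbidden submatrix for the circular-ones property. -/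

import Mathlib

/-- A binary matrix of arbitrary finite size; `true` stands for `1` and `false` for `0`. -/
structure BinMatrix where
  numRows : ℕ
  numCols : ℕ
  mat : Matrix (Fin numRows) (Fin numCols) Bool

/-- The circular-ones property (for rows): the columns can be arranged circularly (the column put
in position `j` is `σ j`, positions being taken modulo the number of columns) so that the `1`s of
each row occupy consecutive positions `s, s + 1, …, s + n - 1` of the circular arrangement. -/
def BinMatrix.HasCircularOnes (M : BinMatrix) : Prop :=
  ∃ σ : Equiv.Perm (Fin M.numCols), ∀ i : Fin M.numRows, ∃ s n : ℕ,
    ∀ j : Fin M.numCols, M.mat i (σ j) = true ↔ ∃ t < n, (j : ℕ) = (s + t) % M.numCols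

/-- `N` is a submatrix of `M`: it is obtained by keeping some of the rows and some of the columns
of `M`, in their order. -/
def BinMatrix.IsSubmatrix (N M : BinMatrix) : Prop :=
  ∃ (f : Fin N.numRows ↪o Fin M.numRows) (g : Fin N.numCols ↪o Fin M.numCols),
    N.mat = M.mat.submatrix f g

/-- `M` and `N` are equal up to permutations of rows and of columns. -/
def BinMatrix.SameConfiguration (M N : BinMatrix) : Prop :=
  ∃ (ρ : Fin N.numRows ≃ Fin M.numRows) (τ : Fin N.numCols ≃ Fin M.numCols),
    N.mat = M.mat.submatrix ρ τ

/-- `M` contains `F` as a configuration: some submatrix of `M` equals `F` up to permutations of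
rows and of columns. -/
def BinMatrix.ContainsConfiguration (M F : BinMatrix) : Prop :=
  ∃ N : BinMatrix, N.IsSubmatrix M ∧ N.SameConfiguration F

/-- `M` is a minimal forbidden submatrix for the circular-ones property. -/
def BinMatrix.IsMinimalForbidden (M : BinMatrix) : Prop :=
  ¬ M.HasCircularOnes ∧ ∀ N : BinMatrix, N.IsSubmatrix M → N ≠ M → N.HasCircularOnes

/-- The shift `a₂ a₃ … aₖ a₁` of a binary sequence `a₁ a₂ … aₖ`. -/
def shiftSeq {k : ℕ} (a : Fin k → Bool) : Fin k → Bool := fun i => a (finRotate k i)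

/-- The reversal `aₖ … a₂ a₁` of a binary sequence `a₁ a₂ … aₖ`. -/
def reverseSeq {k : ℕ} (a : Fin k → Bool) : Fin k → Bool := fun i => a i.rev

/-- Equality of binary sequences up to shifts and reversals. -/
def ShiftRevEquiv {k : ℕ} : (Fin k → Bool) → (Fin k → Bool) → Prop :=
  Relation.EqvGen fun a b => b = shiftSeq a ∨ b = reverseSeq a

/-- A binary bracelet: a lexicographically smallest element of a class of binary sequences under
shifts and reversals. -/
def IsBracelet {k : ℕ} (a : Fin k → Bool) : Prop :=
  ∀ b : Fin k → Bool, ShiftRevEquiv a b → toLex a ≤ toLex b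

/-- `A₃ = {000, 111}`, and otherwise `Aₖ` is the set of binary bracelets of length `k`. -/
def braceletSet (k : ℕ) : Set (Fin k → Bool) :=
  {a | if k = 3 then (a = fun _ => false) ∨ (a = fun _ => true) else IsBracelet a}

/-- `a ⊙ M`: complement those rows `i` of `M` for which `a i = 1`. -/
def complementRows {k l : ℕ} (a : Fin k → Bool) (M : Matrix (Fin k) (Fin l) Bool) :
    Matrix (Fin k) (Fin l) Bool :=
  Matrix.of fun i j => if a i = true then !(M i j) else M i j

/-- The complement of a matrix. -/
def complementMatrix {k l : ℕ} (M : Matrix (Fin k) (Fin l) Bool) :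
    Matrix (Fin k) (Fin l) Bool :=
  Matrix.of fun i j => !(M i j)

/-- `M*`: add one last column consisting entirely of `0`s. -/
def starMatrix {k l : ℕ} (M : Matrix (Fin k) (Fin l) Bool) :
    Matrix (Fin k) (Fin (l + 1)) Bool :=
  Matrix.of fun i j => if h : (j : ℕ) < l then M i ⟨j, h⟩ else false

/-- The Tucker matrix `M_I(k)`: row `i` has its `1`s in columns `i` and `i + 1` modulo `k`. -/
def tuckerI (k : ℕ) : Matrix (Fin k) (Fin k) Bool :=
  Matrix.of fun i j => decide ((j : ℕ) = i ∨ (j : ℕ) = (i + 1) % k)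

/-- The Tucker matrix `M_IV`. -/
def tuckerIV : Matrix (Fin 4) (Fin 6) Bool :=
  !![ true,  true, false, false, false, false;
     false, false,  true,  true, false, false;
     false, false, false, false,  true,  true;
     false,  true, false,  true, false,  true]

/-- The Tucker matrix `M_V`. -/
def tuckerV : Matrix (Fin 4) (Fin 5) Bool :=
  !![ true,  true, false, false, false;
      true,  true,  true,  true, false;
     false, false,  true,  true, false;
      true, false, false,  true,  true]

/-- The set `ForbRow`. -/
def ForbRow : Set BinMatrix :=
  {F | ∃ k : ℕ, 3 ≤ k ∧ ∃ a ∈ braceletSet k,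
      F = ⟨k, k + 1, complementRows a (starMatrix (tuckerI k))⟩} ∪
  {⟨4, 6, tuckerIV⟩, ⟨4, 6, complementMatrix tuckerIV⟩,
    ⟨4, 6, starMatrix tuckerV⟩, ⟨4, 6, complementMatrix (starMatrix tuckerV)⟩}

/-- The matrices with the circular-ones property are exactly those that contain no member of `S`
as a configuration. -/
def CharacterizesCircularOnes (S : Set BinMatrix) : Prop :=
  ∀ M : BinMatrix, M.HasCircularOnes ↔ ∀ F ∈ S, ¬ M.ContainsConfiguration F

/-!
A row of a matrix is treated as a split of the columns into two sides: the circular-ones property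
does not change when a row is complemented, since it says that the two values of a row do not
alternate along four columns of the arrangement (`IsArcOn`, `hasCircularOnes_iff`).

Up to complementing rows, the members of `ForbRow` are of two kinds: a cycle `M_I(k)*`
(`IsCycleOn`), and a transversal configuration `M_IV` (`IsTransversalOn`), in which three rows cut
off disjoint pairs of columns and a fourth row splits each of the pairs. The matrix `M_V*` is
`M_IV` with one row complemented. The heart of the proof is that a family of rows containing
neither kind has a common circular arrangement (`exists_arrangement_of_not_hasObstruction`).

Enlarge the family to a maximal family `S` without obstructions. Complementing a row changes
nothing, so `S` is closed under complements. It is also closed under the intersection of two rows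
that miss a common column `o`: if adding `A ∩ B` created a cycle or a transversal configuration,
then `A`, `B`, the other rows and the column `o` would already give one
(`hasObstruction_of_cycle_and`, `hasObstruction_of_pair_and`, `hasObstruction_of_triple_and`).
Finally `S` contains no star, that is, no four columns split into pairs in all three ways, because
a star is a cycle of length three. A star-free family with these closure properties is arranged
by inserting the columns one at a time (`exists_arrangement_of_closed`): if `a` and `b` lie in an
inclusion-minimal nontrivial row, then any nontrivial row separating them meets that row in one of
them only, and `a` can be placed next to `b`, on a side on which all these rows agree, since two
rows that disagree would complete a star.

Conversely, deleting a row or a column of a cycle or of a transversal configuration leaves a matrix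
with an obvious arrangement, whence the minimality of the members of `ForbRow`. They have pairwise
different configurations. For the cycles this is the statement that an adjacency-preserving
permutation of the rows of a cycle is a rotation or a reflection (`eq_rotation_or_reflection`), and
bracelets represent binary sequences up to these; on three rows, where a row with two ones does not
reveal whether it was complemented, only the parity of the number of complemented rows matters.
Hence no member contains another, and none can be omitted.
-/

/-! ### Arrangements of closed families -/

/-- `C` is an arc of the circular arrangement of `Y` obtained by closing up the linear order in
which `f` lists `Y`: the values of `C` do not alternate along four points of `Y`. This condition is
invariant under complementing `C` and under cutting the circle elsewhere. -/
def IsArcOn {X : Type*} (f : X → ℤ) (Y : Finset X) (C : X → Bool) : Prop :=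
  ∀ x ∈ Y, ∀ y ∈ Y, ∀ z ∈ Y, ∀ t ∈ Y, f x < f y → f y < f z → f z < f t →
    ¬ (C x = C z ∧ C y = C t ∧ C x ≠ C y)

/-- The row `C` has `x`, `y` on one side and `z`, `t` on the other. -/
def Separates {X : Type*} (C : X → Bool) (x y z t : X) : Prop :=
  C x = C y ∧ C z = C t ∧ C x ≠ C z

/-- Four columns that are split into two pairs in all three ways by rows of `R`. -/
def HasStar {X : Type*} (R : Set (X → Bool)) : Prop :=
  ∃ o x y z : X, (∃ C ∈ R, Separates C o x y z) ∧ (∃ C ∈ R, Separates C o y x z) ∧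
    ∃ C ∈ R, Separates C o z x y

/-- The circle may be cut just after any given point. -/
theorem exists_rotation {X : Type*} (f : X → ℤ) (Y : Finset X) (hf : Set.InjOn f Y) {b : X}
    (hb : b ∈ Y) :
    ∃ g : X → ℤ, Set.InjOn g Y ∧ (∀ x ∈ Y, x ≠ b → g x < g b) ∧
      ∀ C, IsArcOn f Y C → IsArcOn g Y C := by
  obtain ⟨N, hN⟩ : ∃ N : ℤ, ∀ x ∈ Y, |f x| ≤ N := by
    refine ⟨∑ x ∈ Y, |f x|, fun x hx => ?_⟩
    exact Finset.single_le_sum (f := fun x => |f x|) (fun i _ => abs_nonneg _) hx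
  have hlt : ∀ x ∈ Y, ∀ y ∈ Y, f x - (2 * N + 1) < f y := by
    intro x hx y hy
    have h1 := abs_le.1 (hN x hx)
    have h2 := abs_le.1 (hN y hy)
    omega
  refine ⟨fun x => if f x ≤ f b then f x else f x - (2 * N + 1), ?_, ?_, ?_⟩
  · intro x hx y hy hxy
    have h1 := hlt x hx y hy
    have h2 := hlt y hy x hx
    apply hf hx hy
    simp only at hxy
    split_ifs at hxy <;> omega
  · intro x hx hxb
    have h1 := hlt x hx b hb
    have h2 : f x ≠ f b := fun h => hxb (hf hx hb h)
    simp only [le_refl, if_true]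
    split_ifs <;> omega
  · intro C hC x hx y hy z hz t ht hxy hyz hzt
    have hxy' := hlt y hy x hx
    have hyz' := hlt z hz y hy
    have hzt' := hlt t ht z hz
    have h1 := hlt x hx t ht
    simp only at hxy hyz hzt
    rintro ⟨e1, e2, e3⟩
    by_cases cx : f x ≤ f b
    · have cy : f y ≤ f b := by by_contra h; simp only [cx, h, if_true, if_false] at hxy; omega
      have cz : f z ≤ f b := by by_contra h; simp only [cy, h, if_true, if_false] at hyz; omega
      have ct : f t ≤ f b := by by_contra h; simp only [cz, h, if_true, if_false] at hzt; omega
      simp only [cx, cy, cz, ct, if_true] at hxy hyz hzt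
      exact hC x hx y hy z hz t ht hxy hyz hzt ⟨e1, e2, e3⟩
    · by_cases cy : f y ≤ f b
      · have cz : f z ≤ f b := by by_contra h; simp only [cy, h, if_true, if_false] at hyz; omega
        have ct : f t ≤ f b := by by_contra h; simp only [cz, h, if_true, if_false] at hzt; omega
        simp only [cx, cy, cz, ct, if_true, if_false] at hxy hyz hzt
        exact hC y hy z hz t ht x hx hyz hzt (by omega) ⟨e2, e1.symm, by rw [← e1]; exact e3.symm⟩
      · by_cases cz : f z ≤ f b
        · have ct : f t ≤ f b := by by_contra h; simp only [cz, h, if_true, if_false] at hzt; omega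
          simp only [cx, cy, cz, ct, if_true, if_false] at hxy hyz hzt
          exact hC z hz t ht x hx y hy hzt (by omega) (by omega) ⟨e1.symm, e2.symm, by grind⟩
        · by_cases ct : f t ≤ f b
          · simp only [cx, cy, cz, ct, if_true, if_false] at hxy hyz hzt
            exact hC t ht x hx y hy z hz (by omega) (by omega) (by omega)
              ⟨e2.symm, e1, by grind⟩
          · simp only [cx, cy, cz, ct, if_false] at hxy hyz hzt
            exact hC x hx y hy z hz t ht (by omega) (by omega) (by omega) ⟨e1, e2, e3⟩

/-- A row that is constant on `Y` up to one exception is an arc in every arrangement. -/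
theorem isArcOn_of_trivial {X : Type*} (f : X → ℤ) (Y : Finset X) (C : X → Bool) (v : Bool)
    (h : ∀ x ∈ Y, ∀ y ∈ Y, C x = v → C y = v → x = y) : IsArcOn f Y C := by
  intro x hx y hy z hz t ht hxy hyz hzt ⟨e1, e2, e3⟩
  by_cases hv : C x = v
  · have := h x hx z hz hv (e1 ▸ hv)
    subst this; omega
  · have hv' : C y = v := by
      revert hv e3; cases C x <;> cases C y <;> cases v <;> simp
    have := h y hy t ht hv' (e2 ▸ hv')
    subst this; omega

/-- A family of rows that is closed under complements and under intersections of rows that do not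
cover all columns has a common circular arrangement, unless it contains a star. The columns are
inserted one at a time: if `{a, b}` lies in an inclusion-minimal nontrivial row, then `a` fits
immediately before or immediately after `b` in any arrangement of the other columns. -/
theorem exists_arrangement_of_closed {X : Type*} (R : Set (X → Bool))
    (hnot : ∀ A ∈ R, (fun x => !A x) ∈ R)
    (hand : ∀ A ∈ R, ∀ B ∈ R, ∀ o, A o = false → B o = false → (fun x => A x && B x) ∈ R)
    (hstar : ¬ HasStar R) (Y : Finset X) :
    ∃ f : X → ℤ, Set.InjOn f Y ∧ ∀ C ∈ R, IsArcOn f Y C := by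
  classical
  induction hn : Y.card using Nat.strong_induction_on generalizing Y with
  | _ n ih =>
  by_cases hex : ∃ A ∈ R, 2 ≤ (Y.filter (fun x => A x = true)).card ∧
      2 ≤ (Y.filter (fun x => A x = false)).card
  swap
  · -- every row is trivial
    obtain ⟨f, hf⟩ : ∃ f : X → ℤ, Set.InjOn f Y := by
      refine ⟨fun x => if h : x ∈ Y then ((Y.equivFin ⟨x, h⟩ : ℕ) : ℤ) else 0, ?_⟩
      intro x hx y hy hxy
      have hx' : x ∈ Y := hx
      have hy' : y ∈ Y := hy
      simp only [hx', hy', dif_pos] at hxy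
      have h2 := Y.equivFin.injective (Fin.ext (by exact_mod_cast hxy))
      exact congrArg Subtype.val h2
    refine ⟨f, hf, fun C hC => ?_⟩
    have h2 : (Y.filter (fun x => C x = true)).card ≤ 1 ∨
        (Y.filter (fun x => C x = false)).card ≤ 1 := by
      by_contra hcon
      push Not at hcon
      exact hex ⟨C, hC, hcon.1, hcon.2⟩
    rcases h2 with h2 | h2
    · refine isArcOn_of_trivial f Y C true fun x hx y hy h3 h4 => ?_
      exact Finset.card_le_one.1 h2 x (by simp [hx, h3]) y (by simp [hy, h4])
    · refine isArcOn_of_trivial f Y C false fun x hx y hy h3 h4 => ?_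
      exact Finset.card_le_one.1 h2 x (by simp [hx, h3]) y (by simp [hy, h4])
  -- a nontrivial row with the least number of ones
  obtain ⟨A, ⟨hAR, hA1, hA2⟩, hmin⟩ :
      ∃ A, (A ∈ R ∧ 2 ≤ (Y.filter (fun x => A x = true)).card ∧
        2 ≤ (Y.filter (fun x => A x = false)).card) ∧
        ∀ B ∈ R, (Y.filter (fun x => B x = true)) ⊂ (Y.filter (fun x => A x = true)) →
          2 ≤ (Y.filter (fun x => B x = false)).card →
          (Y.filter (fun x => B x = true)).card ≤ 1 := by
    let P : ℕ → Prop := fun c => ∃ A ∈ R, (Y.filter (fun x => A x = true)).card = c ∧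
      2 ≤ (Y.filter (fun x => A x = true)).card ∧ 2 ≤ (Y.filter (fun x => A x = false)).card
    have hP : ∃ c, P c := by
      obtain ⟨A, hA, h1, h2⟩ := hex
      exact ⟨_, A, hA, rfl, h1, h2⟩
    obtain ⟨A, hA, hc, h1, h2⟩ := Nat.find_spec hP
    refine ⟨A, ⟨hA, h1, h2⟩, fun B hB hsub hB2 => ?_⟩
    by_contra hcon
    have hlt := Finset.card_lt_card hsub
    exact Nat.find_min hP (hc ▸ hlt) ⟨B, hB, rfl, by omega, hB2⟩
  obtain ⟨a, ha, b, hb, hab⟩ := Finset.one_lt_card.1 hA1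
  obtain ⟨haY, haA⟩ := Finset.mem_filter.1 ha
  obtain ⟨hbY, hbA⟩ := Finset.mem_filter.1 hb
  have hbY' : b ∈ Y.erase a := Finset.mem_erase.2 ⟨hab.symm, hbY⟩
  obtain ⟨f0, hf0, hR0⟩ := ih _ (hn ▸ Finset.card_erase_lt_of_mem haY) (Y.erase a) rfl
  obtain ⟨f, hf, hfb, hrot⟩ := exists_rotation f0 (Y.erase a) hf0 hbY'
  have hR : ∀ C ∈ R, IsArcOn f (Y.erase a) C := fun C hC => hrot C (hR0 C hC)
  -- the nontrivial rows separating `a` from `b` cross `A`, and then `A` is `{a, b}` on `Y`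
  have hcross : ∀ C ∈ R, C b = true → C a = false →
      2 ≤ (Y.filter (fun x => C x = true)).card → 2 ≤ (Y.filter (fun x => C x = false)).card →
      (∀ x ∈ Y, A x = true → x = a ∨ x = b) ∧ (∃ o ∈ Y, A o = false ∧ C o = false) ∧
        ∃ o ∈ Y, A o = false ∧ C o = true := by
    intro C hC hCb hCa hC1 hC2
    have key : ∀ (C : X → Bool) (b a : X), C ∈ R → b ∈ Y → a ∈ Y → A a = true → A b = true →
        C b = true → C a = false →
        2 ≤ (Y.filter (fun x => C x = true)).card → 2 ≤ (Y.filter (fun x => C x = false)).card →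
        (∃ o ∈ Y, A o = false ∧ C o = false) ∧ ∀ x ∈ Y, A x = true → C x = true → x = b := by
      intro C b a hC hbY haY haA hbA hCb hCa hC1 hC2
      have ho : ∃ o ∈ Y, A o = false ∧ C o = false := by
        by_contra hcon
        push Not at hcon
        have h := hmin _ (hnot C hC) ?_ (by simpa using hC1)
        · simp only [Bool.not_eq_true'] at h; omega
        · rw [Finset.ssubset_iff_of_subset]
          · exact ⟨b, by simp [hbY, hbA], by simp [hCb]⟩
          · intro x hx
            simp only [Finset.mem_filter, Bool.not_eq_true'] at hx ⊢
            refine ⟨hx.1, ?_⟩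
            by_contra h
            exact hcon x hx.1 (by simpa using h) hx.2
      refine ⟨ho, ?_⟩
      obtain ⟨o, hoY, hoA, hoC⟩ := ho
      have h := hmin _ (hand A hAR C hC o hoA hoC) ?_ ?_
      · intro x hx h1 h2
        exact Finset.card_le_one.1 h x (by simp [hx, h1, h2]) b (by simp [hbY, hbA, hCb])
      · rw [Finset.ssubset_iff_of_subset]
        · exact ⟨a, by simp [haY, haA], by simp [hCa]⟩
        · intro x hx
          simp only [Finset.mem_filter, Bool.and_eq_true] at hx ⊢
          exact ⟨hx.1, hx.2.1⟩
      · refine hA2.trans (Finset.card_le_card fun x hx => ?_)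
        simp only [Finset.mem_filter] at hx ⊢
        exact ⟨hx.1, by simp [hx.2]⟩
    obtain ⟨h1, h2⟩ := key C b a hC hbY haY haA hbA hCb hCa hC1 hC2
    obtain ⟨h3, h4⟩ := key (fun x => !C x) a b (hnot C hC) haY hbY hbA haA (by simp [hCa])
      (by simp [hCb]) (by simpa using hC2) (by simpa using hC1)
    refine ⟨fun x hx hxA => ?_, h1, ?_⟩
    · cases hCx : C x
      · exact Or.inl (h4 x hx hxA (by simp [hCx]))
      · exact Or.inr (h2 x hx hxA hCx)
    · obtain ⟨o, ho, ho1, ho2⟩ := h3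
      exact ⟨o, ho, ho1, by simpa using ho2⟩
  -- the first and the last column before `b`
  obtain ⟨o, hoY, hoA⟩ : ∃ o ∈ Y, A o = false := by
    obtain ⟨o, ho⟩ := Finset.card_pos.1 (by omega : 0 < (Y.filter (fun x => A x = false)).card)
    exact ⟨o, by simpa using ho⟩
  have hne : ((Y.erase a).erase b).Nonempty :=
    ⟨o, by
      simp only [Finset.mem_erase]
      exact ⟨by rintro rfl; simp [hbA] at hoA, by rintro rfl; simp [haA] at hoA, hoY⟩⟩
  obtain ⟨u, hu, humin⟩ := Finset.exists_min_image _ f hne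
  obtain ⟨v, hv, hvmax⟩ := Finset.exists_max_image _ f hne
  simp only [Finset.mem_erase] at hu hv humin hvmax
  have hend : ∀ C ∈ R, C b = true → C a = false →
      2 ≤ (Y.filter (fun x => C x = true)).card → 2 ≤ (Y.filter (fun x => C x = false)).card →
      A u = false ∧ A v = false ∧ C u ≠ C v := by
    intro C hC hCb hCa hC1 hC2
    obtain ⟨h1, ⟨p, hpY, hpA, hpC⟩, q, hqY, hqA, hqC⟩ := hcross C hC hCb hCa hC1 hC2
    have hAu : A u = false := by
      cases h : A u
      · rfl
      · rcases h1 u hu.2.2 h with h | h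
        · exact absurd h hu.2.1
        · exact absurd h hu.1
    have hAv : A v = false := by
      cases h : A v
      · rfl
      · rcases h1 v hv.2.2 h with h | h
        · exact absurd h hv.2.1
        · exact absurd h hv.1
    refine ⟨hAu, hAv, fun huv => ?_⟩
    have hnotA : ∀ x, A x = false → x ≠ a ∧ x ≠ b := by
      intro x hx
      exact ⟨by rintro rfl; simp [haA] at hx, by rintro rfl; simp [hbA] at hx⟩
    have huY' : u ∈ Y.erase a := Finset.mem_erase.2 hu.2
    have hvY' : v ∈ Y.erase a := Finset.mem_erase.2 hv.2
    have hvb := hfb v hvY' hv.1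
    have hstrict : ∀ x ∈ Y, A x = false → C x ≠ C u → f u < f x ∧ f x < f v := by
      intro x hx hxA hxC
      obtain ⟨hxa, hxb⟩ := hnotA x hxA
      have hxY' : x ∈ Y.erase a := Finset.mem_erase.2 ⟨hxa, hx⟩
      have h1 := humin x ⟨hxb, hxa, hx⟩
      have h2 := hvmax x ⟨hxb, hxa, hx⟩
      have h3 : f u ≠ f x := fun h => hxC (by rw [hf huY' hxY' h])
      have h4 : f v ≠ f x := fun h => hxC (by rw [huv, hf hvY' hxY' h])
      omega
    cases hCu : C u
    · obtain ⟨h5, h6⟩ := hstrict q hqY hqA (by simp [hqC, hCu])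
      refine hR C hC u huY' q (Finset.mem_erase.2 ⟨(hnotA q hqA).1, hqY⟩) v hvY' b hbY' h5 h6 hvb
        ⟨huv, by rw [hqC, hCb], by simp [hCu, hqC]⟩
    · obtain ⟨h5, h6⟩ := hstrict p hpY hpA (by simp [hpC, hCu])
      -- `C` without `b` is a row of the family as well
      have hCA := hand C hC _ (hnot A hAR) a hCa (by simp [haA])
      refine hR _ hCA u huY' p (Finset.mem_erase.2 ⟨(hnotA p hpA).1, hpY⟩) v hvY' b hbY' h5 h6 hvb
        ⟨by simp [huv, hAu, hAv], by simp [hpC, hbA], by simp [hCu, hpC, hAu]⟩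
  -- all crossing rows leave `b` on the same side
  have hside : (∀ C ∈ R, C b = true → C a = false →
      2 ≤ (Y.filter (fun x => C x = true)).card → 2 ≤ (Y.filter (fun x => C x = false)).card →
      C u = true ∧ C v = false) ∨ (∀ C ∈ R, C b = true → C a = false →
      2 ≤ (Y.filter (fun x => C x = true)).card → 2 ≤ (Y.filter (fun x => C x = false)).card →
      C u = false ∧ C v = true) := by
    by_contra hcon
    push Not at hcon
    obtain ⟨⟨C, hC, hCb, hCa, hC1, hC2, hC3⟩, D, hD, hDb, hDa, hD1, hD2, hD3⟩ := hcon
    obtain ⟨hAu, hAv, h1⟩ := hend C hC hCb hCa hC1 hC2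
    obtain ⟨-, -, h2⟩ := hend D hD hDb hDa hD1 hD2
    have hC4 : C u = false ∧ C v = true := by
      revert hC3 h1; cases C u <;> cases C v <;> simp
    have hD4 : D u = true ∧ D v = false := by
      revert hD3 h2; cases D u <;> cases D v <;> simp
    exact hstar ⟨b, a, u, v, ⟨A, hAR, by simp [Separates, hbA, haA, hAu, hAv]⟩,
      ⟨D, hD, by simp [Separates, hDb, hDa, hD4]⟩, C, hC, by simp [Separates, hCb, hCa, hC4]⟩
  have huY' : u ∈ Y.erase a := Finset.mem_erase.2 hu.2
  have hvY' : v ∈ Y.erase a := Finset.mem_erase.2 hv.2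
  -- it remains to insert `a` next to `b`, at the position `2 * f b + e` after doubling
  have hinsert : ∀ e : ℤ, (e = 1 ∨ e = -1) →
      (∀ C ∈ R, C b = true → C a = false → 2 ≤ (Y.filter (fun x => C x = true)).card →
        2 ≤ (Y.filter (fun x => C x = false)).card →
        (e = -1 → C u = true ∧ C v = false) ∧ (e = 1 → C u = false ∧ C v = true)) →
      ∃ f : X → ℤ, Set.InjOn f Y ∧ ∀ C ∈ R, IsArcOn f Y C := by
    intro e he hCe
    let g : X → ℤ := fun x => if x = a then 2 * f b + e else 2 * f x
    have hga : g a = 2 * f b + e := by simp [g]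
    have hg : ∀ x, x ≠ a → g x = 2 * f x := fun x hx => by simp [g, hx]
    have hgcases : ∀ x ∈ Y, x = a ∨ (x ∈ Y.erase a ∧ g x = 2 * f x ∧ (x = b ∨ f x < f b)) := by
      intro x hx
      by_cases hxa : x = a
      · exact Or.inl hxa
      · have hx' : x ∈ Y.erase a := Finset.mem_erase.2 ⟨hxa, hx⟩
        refine Or.inr ⟨hx', hg x hxa, ?_⟩
        by_cases hxb : x = b
        · exact Or.inl hxb
        · exact Or.inr (hfb x hx' hxb)
    refine ⟨g, ?_, ?_⟩
    · intro x hx y hy hxy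
      rcases hgcases x hx with rfl | ⟨hx', h1, -⟩ <;> rcases hgcases y hy with rfl | ⟨hy', h2, -⟩
      · rfl
      · omega
      · omega
      · exact hf hx' hy' (by omega)
    -- an alternation avoiding `a` is impossible
    have hold : ∀ C ∈ R, ∀ x ∈ Y.erase a, ∀ y ∈ Y.erase a, ∀ z ∈ Y.erase a, ∀ t ∈ Y.erase a,
        g x < g y → g y < g z → g z < g t → ¬ (C x = C z ∧ C y = C t ∧ C x ≠ C y) := by
      intro C hC x hx y hy z hz t ht h1 h2 h3
      rw [hg x (Finset.ne_of_mem_erase hx), hg y (Finset.ne_of_mem_erase hy)] at h1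
      rw [hg z (Finset.ne_of_mem_erase hz), hg y (Finset.ne_of_mem_erase hy)] at h2
      rw [hg z (Finset.ne_of_mem_erase hz), hg t (Finset.ne_of_mem_erase ht)] at h3
      exact hR C hC x hx y hy z hz t ht (by omega) (by omega) (by omega)
    -- rows that contain `b` but not `a`
    have hsep : ∀ C ∈ R, C b = true → C a = false → IsArcOn g Y C := by
      intro C hC hCb hCa
      by_cases hC1 : 2 ≤ (Y.filter (fun x => C x = true)).card
      swap
      · refine isArcOn_of_trivial g Y C true fun x hx y hy h3 h4 => ?_
        exact Finset.card_le_one.1 (by omega : (Y.filter (fun x => C x = true)).card ≤ 1) x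
          (by simp [hx, h3]) y (by simp [hy, h4])
      by_cases hC2 : 2 ≤ (Y.filter (fun x => C x = false)).card
      swap
      · refine isArcOn_of_trivial g Y C false fun x hx y hy h3 h4 => ?_
        exact Finset.card_le_one.1 (by omega : (Y.filter (fun x => C x = false)).card ≤ 1) x
          (by simp [hx, h3]) y (by simp [hy, h4])
      obtain ⟨hm, hp⟩ := hCe C hC hCb hCa hC1 hC2
      have huv : ∀ x ∈ Y.erase a, x ≠ b → f u ≤ f x ∧ f x ≤ f v := fun x hx hxb =>
        ⟨humin x ⟨hxb, Finset.mem_erase.1 hx⟩, hvmax x ⟨hxb, Finset.mem_erase.1 hx⟩⟩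
      have hneq : ∀ x ∈ Y.erase a, ∀ y ∈ Y.erase a, C x ≠ C y → f x ≠ f y :=
        fun x hx y hy hxy h => hxy (by rw [hf hx hy h])
      have hArc := hR C hC
      intro x hx y hy z hz t ht hxy hyz hzt ⟨e1, e2, e3⟩
      rcases he with rfl | rfl
      · -- `a` comes last
        obtain ⟨hCu, hCv⟩ := hp rfl
        have hnlast : ∀ s ∈ Y, ∀ r ∈ Y, g s < g r → s ∈ Y.erase a ∧ g s = 2 * f s := by
          intro s hs r hr hsr
          rcases hgcases s hs with rfl | ⟨h1, h2, -⟩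
          · rcases hgcases r hr with rfl | ⟨-, h4, rfl | h5⟩ <;> omega
          · exact ⟨h1, h2⟩
        obtain ⟨hx', hgx⟩ := hnlast x hx y hy hxy
        obtain ⟨hy', hgy⟩ := hnlast y hy z hz hyz
        obtain ⟨hz', hgz⟩ := hnlast z hz t ht hzt
        rcases hgcases t ht with rfl | ⟨ht', -, -⟩
        · have hCy : C y = false := by rw [e2, hCa]
          have hCx : C x = true := by revert e3; rw [hCy]; simp
          have hyb : y ≠ b := by rintro rfl; simp [hCb] at hCy
          have hxb : x ≠ b := by
            rintro rfl
            have := hfb y hy' hyb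
            omega
          have h1 := (huv x hx' hxb).1
          have h2 := hneq u huY' x hx' (by simp [hCu, hCx])
          have h3 := hfb y hy' hyb
          exact hArc u huY' x hx' y hy' b hbY' (by omega) (by omega) h3
            ⟨by rw [hCu, hCy], by rw [hCx, hCb], by simp [hCu, hCx]⟩
        · exact hold C hC x hx' y hy' z hz' t ht' hxy hyz hzt ⟨e1, e2, e3⟩
      · -- `a` comes last but one, before `b`
        obtain ⟨hCu, hCv⟩ := hm rfl
        have hafter : ∀ s ∈ Y, g a < g s → s = b := by
          intro s hs hsr
          rcases hgcases s hs with rfl | ⟨-, h2, h | h5⟩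
          · omega
          · exact h
          · omega
        have hnb : ∀ s ∈ Y, ∀ r ∈ Y, g s < g r → s ≠ b := by
          rintro s hs r hr hsr rfl
          rcases hgcases s hs with rfl | ⟨-, h2, -⟩
          · exact hab rfl
          rcases hgcases r hr with rfl | ⟨-, h4, rfl | h5⟩ <;> omega
        have hxb := hnb x hx y hy hxy
        have hyb := hnb y hy z hz hyz
        have hzb := hnb z hz t ht hzt
        rcases hgcases x hx with rfl | ⟨hx', hgx, -⟩
        · exact hyb (hafter y hy hxy)
        rcases hgcases y hy with rfl | ⟨hy', hgy, -⟩
        · exact hzb (hafter z hz hyz)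
        rcases hgcases z hz with rfl | ⟨hz', hgz, -⟩
        · have htb := hafter t ht hzt
          subst htb
          have hCx : C x = false := by rw [e1, hCa]
          have hCy : C y = true := by rw [e2, hCb]
          have h1 := (huv x hx' hxb).1
          have h2 := (huv y hy' hyb).2
          have h3 := hneq u huY' x hx' (by simp [hCu, hCx])
          have h4 := hneq y hy' v hvY' (by simp [hCv, hCy])
          exact hArc u huY' x hx' y hy' v hvY' (by omega) (by omega) (by omega)
            ⟨by rw [hCu, hCy], by rw [hCx, hCv], by simp [hCu, hCx]⟩
        rcases hgcases t ht with rfl | ⟨ht', hgt, -⟩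
        · have hCy : C y = false := by rw [e2, hCa]
          have hCx : C x = true := by revert e3; rw [hCy]; simp
          have hCz : C z = true := by rw [← e1, hCx]
          have h2 := (huv z hz' hzb).2
          have h4 := hneq z hz' v hvY' (by simp [hCv, hCz])
          exact hArc x hx' y hy' z hz' v hvY' (by omega) (by omega) (by omega)
            ⟨e1, by rw [hCy, hCv], by simp [hCy, hCx]⟩
        · exact hold C hC x hx' y hy' z hz' t ht' hxy hyz hzt ⟨e1, e2, e3⟩
    intro C hC
    by_cases hCab : C a = C b
    swap
    · cases hCb : C b
      · have h := hsep _ (hnot C hC) (by simp [hCb])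
          (by revert hCab; rw [hCb]; cases C a <;> simp)
        intro x hx y hy z hz t ht hxy hyz hzt ⟨e1, e2, e3⟩
        exact h x hx y hy z hz t ht hxy hyz hzt ⟨by simp [e1], by simp [e2], by simpa using e3⟩
      · exact hsep C hC hCb (by revert hCab; rw [hCb]; cases C a <;> simp)
    -- rows that do not separate `a` from `b`
    intro x hx y hy z hz t ht hxy hyz hzt ⟨e1, e2, e3⟩
    -- replacing `a` by `b` keeps the weak order
    let s : X → X := fun x => if x = a then b else x
    have hsC : ∀ x, C (s x) = C x := by
      intro x
      by_cases h : x = a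
      · simp [s, h, hCab]
      · simp [s, h]
    have hsY : ∀ x ∈ Y, s x ∈ Y.erase a := by
      intro x hx
      by_cases h : x = a
      · simpa [s, h] using hbY'
      · simpa [s, h] using hx
    have hslt : ∀ x ∈ Y, ∀ y ∈ Y, C x ≠ C y → g x < g y → f (s x) < f (s y) := by
      intro x hx y hy hC hxy
      have hsx : f (s x) ≠ f (s y) := by
        intro h
        have := hf (hsY x hx) (hsY y hy) h
        exact hC (by rw [← hsC x, this, hsC])
      by_cases hxa : x = a
      · by_cases hya : y = a
        · subst hxa; subst hya; omega
        · have hy2 : s y = y := by simp [s, hya]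
          have hx2 : s x = b := by simp [s, hxa]
          rw [hx2, hy2] at hsx ⊢
          rw [hxa, hga, hg y hya] at hxy
          omega
      · have hx2 : s x = x := by simp [s, hxa]
        by_cases hya : y = a
        · have hy2 : s y = b := by simp [s, hya]
          rw [hx2, hy2] at hsx ⊢
          rw [hya, hga, hg x hxa] at hxy
          omega
        · have hy2 : s y = y := by simp [s, hya]
          rw [hx2, hy2]
          rw [hg x hxa, hg y hya] at hxy
          omega
    refine hR C hC _ (hsY x hx) _ (hsY y hy) _ (hsY z hz) _ (hsY t ht)
      (hslt x hx y hy e3 hxy) (hslt y hy z hz (by rw [← e1]; exact e3.symm) hyz)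
      (hslt z hz t ht (by rw [← e1, ← e2]; exact e3) hzt) ?_
    rw [hsC, hsC, hsC, hsC]
    exact ⟨e1, e2, e3⟩
  rcases hside with h | h
  · exact hinsert (-1) (Or.inr rfl) fun C hC hCb hCa hC1 hC2 =>
      ⟨fun _ => h C hC hCb hCa hC1 hC2, fun h => by omega⟩
  · exact hinsert 1 (Or.inl rfl) fun C hC hCb hCa hC1 hC2 =>
      ⟨fun h => by omega, fun _ => h C hC hCb hCa hC1 hC2⟩

/-! ### Cycles, transversal configurations and intersections -/

/-- The rows `r 0, …, r (m - 1), E` form a cycle on the columns `p 0, …, p m`, seen from the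
column `w`: the side of `r i` not containing `w` is `{p i, p (i + 1)}`, and the side of the closing
row `E` not containing `w` is `{p 0, p m}`. -/
structure IsCycleOn {X : Type*} (m : ℕ) (p : ℕ → X) (w : X) (r : ℕ → X → Bool) (E : X → Bool) :
    Prop where
  row : ∀ i < m, ∀ j ≤ m, (r i (p j) ≠ r i w ↔ j = i ∨ j = i + 1)
  closing : ∀ j ≤ m, (E (p j) ≠ E w ↔ j = 0 ∨ j = m)

/-- Up to complementing rows, `R` contains the configuration `M_I(m + 1)*` for some `m ≥ 2`. -/
def HasCycle {X : Type*} (R : Set (X → Bool)) : Prop :=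
  ∃ (m : ℕ) (p : ℕ → X) (w : X) (r : ℕ → X → Bool) (E : X → Bool),
    2 ≤ m ∧ (∀ i < m, r i ∈ R) ∧ E ∈ R ∧ IsCycleOn m p w r E

/-- The row `C` has `x₁`, `x₂` on one side and the other four columns on the other. -/
def CutsPair {X : Type*} (C : X → Bool) (x₁ x₂ y₁ y₂ z₁ z₂ : X) : Prop :=
  C x₁ = C x₂ ∧ C y₁ = C y₂ ∧ C z₁ = C y₁ ∧ C z₂ = C y₁ ∧ C x₁ ≠ C y₁

/-- The row `T` has `x₁`, `y₁`, `z₁` on one side and `x₂`, `y₂`, `z₂` on the other. -/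
def CutsTriple {X : Type*} (T : X → Bool) (x₁ x₂ y₁ y₂ z₁ z₂ : X) : Prop :=
  T y₁ = T x₁ ∧ T z₁ = T x₁ ∧ T y₂ = T x₂ ∧ T z₂ = T x₂ ∧ T x₁ ≠ T x₂

/-- Up to complementing rows, the four rows form the configuration `M_IV` on the six columns. The
matrix `M_V*` is also of this form: it is `M_IV` with one of its first three rows complemented. -/
structure IsTransversalOn {X : Type*} (a₁ a₂ b₁ b₂ c₁ c₂ : X) (A B C T : X → Bool) : Prop where
  fst : CutsPair A a₁ a₂ b₁ b₂ c₁ c₂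
  snd : CutsPair B b₁ b₂ c₁ c₂ a₁ a₂
  trd : CutsPair C c₁ c₂ a₁ a₂ b₁ b₂
  transversal : CutsTriple T a₁ a₂ b₁ b₂ c₁ c₂

/-- Up to complementing rows, `R` contains the configuration `M_IV`. -/
def HasTransversal {X : Type*} (R : Set (X → Bool)) : Prop :=
  ∃ (a₁ a₂ b₁ b₂ c₁ c₂ : X) (A B C T : X → Bool),
    A ∈ R ∧ B ∈ R ∧ C ∈ R ∧ T ∈ R ∧ IsTransversalOn a₁ a₂ b₁ b₂ c₁ c₂ A B C T

/-- `R` contains one of the two kinds of obstructions to a circular arrangement. -/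
def HasObstruction {X : Type*} (R : Set (X → Bool)) : Prop := HasCycle R ∨ HasTransversal R

section
variable {X : Type*} {R : Set (X → Bool)}

/-- A star is a cycle of length three. -/
theorem HasStar.hasCycle (h : HasStar R) : HasCycle R := by
  obtain ⟨o, x, y, z, ⟨C₁, hC₁, h₁⟩, ⟨C₂, hC₂, h₂⟩, C₃, hC₃, h₃⟩ := h
  refine ⟨2, fun j => if j = 0 then x else if j = 1 then y else z, o,
    fun i => if i = 0 then C₃ else C₁, C₂, le_rfl, ?_, hC₂, ?_, ?_⟩
  · intro i hi
    dsimp only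
    split_ifs <;> assumption
  · intro i hi j hj
    obtain ⟨a1, a2, a3⟩ := h₁
    obtain ⟨b1, b2, b3⟩ := h₃
    interval_cases i <;> interval_cases j <;> simp <;> grind
  · intro j hj
    obtain ⟨a1, a2, a3⟩ := h₂
    interval_cases j <;> simp <;> grind

theorem HasStar.hasObstruction (h : HasStar R) : HasObstruction R := Or.inl h.hasCycle

/-- The closing row can be chosen to be any of the rows of a cycle. -/
theorem IsCycleOn.rotate {m : ℕ} {p : ℕ → X} {w : X} {r : ℕ → X → Bool} {E : X → Bool}
    (h : IsCycleOn m p w r E) {s : ℕ} (hs : s < m) :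
    IsCycleOn m (fun j => p (if s + 1 + j ≤ m then s + 1 + j else s + j - m)) w
      (fun i => if s + 1 + i = m then E else r (if s + 1 + i ≤ m then s + 1 + i else s + i - m))
      (r s) := by
  constructor
  · intro i hi j hj
    by_cases h1 : s + 1 + i = m
    · rw [if_pos h1, h.closing _ (by split_ifs <;> omega)]
      split_ifs <;> omega
    · rw [if_neg h1, h.row _ (by split_ifs <;> omega) _ (by split_ifs <;> omega)]
      split_ifs <;> omega
  · intro j hj
    rw [h.row s hs _ (by split_ifs <;> omega)]
    split_ifs <;> omega

theorem IsCycleOn.row_ne_closing {m : ℕ} {p : ℕ → X} {w : X} {r : ℕ → X → Bool} {E : X → Bool}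
    (h : IsCycleOn m p w r E) (hm : 2 ≤ m) {i : ℕ} (hi : i < m) : r i ≠ E := by
  intro he
  have h0 := h.row i hi 0 (by omega)
  have h1 := h.row i hi 1 (by omega)
  rw [he, h.closing _ (by omega)] at h0 h1
  omega

/-- A cycle that uses an additional row `D` may be assumed to use it as closing row only. -/
theorem hasCycle_insert {D : X → Bool} (h : HasCycle (insert D R)) :
    HasCycle R ∨ ∃ (m : ℕ) (p : ℕ → X) (w : X) (r : ℕ → X → Bool),
      2 ≤ m ∧ (∀ i < m, r i ∈ R) ∧ IsCycleOn m p w r D := by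
  have key : ∀ (m : ℕ) (p : ℕ → X) (w : X) (r : ℕ → X → Bool), 2 ≤ m →
      (∀ i < m, r i ∈ insert D R) → IsCycleOn m p w r D → ∃ (m : ℕ) (p : ℕ → X) (w : X)
      (r : ℕ → X → Bool), 2 ≤ m ∧ (∀ i < m, r i ∈ R) ∧ IsCycleOn m p w r D :=
    fun m p w r hm hr h => ⟨m, p, w, r, hm, fun i hi =>
      (hr i hi).resolve_left (h.row_ne_closing hm hi), h⟩
  obtain ⟨m, p, w, r, E, hm, hr, hE, h⟩ := h
  by_cases hs : ∃ s < m, r s = D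
  · obtain ⟨s, hs, rfl⟩ := hs
    refine Or.inr (key _ _ _ _ hm (fun i hi => ?_) (h.rotate hs))
    split_ifs
    · exact hE
    · exact hr _ (by omega)
    · exact hr _ (by omega)
  · rcases hE with rfl | hE
    · exact Or.inr (key _ _ _ _ hm hr h)
    · exact Or.inl ⟨m, p, w, r, E, hm, fun i hi => (hr i hi).resolve_left fun h => hs ⟨i, hi, h⟩,
        hE, h⟩

/-- A path of two-column rows from `p 0` to `p m`, together with rows whose complements are
`{p 0, o}` and `{p m, o}`. Whether the new column `o` is on the side of `w` decides which points
of the path can be skipped to obtain a cycle. -/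
theorem hasObstruction_of_path_of_pairs {m : ℕ} {p : ℕ → X} {w o : X} {r : ℕ → X → Bool}
    {A B : X → Bool} (hm : 2 ≤ m) (hr : ∀ i < m, r i ∈ R) (hAR : A ∈ R) (hBR : B ∈ R)
    (h : ∀ i < m, ∀ j ≤ m, (r i (p j) ≠ r i w ↔ j = i ∨ j = i + 1))
    (hAw : A w = true) (hBw : B w = true) (hAo : A o = false) (hBo : B o = false)
    (hA : ∀ j ≤ m, (A (p j) = true ↔ j ≠ 0)) (hB : ∀ j ≤ m, (B (p j) = true ↔ j ≠ m)) :
    HasObstruction R := by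
  have hA0 : A (p 0) = false := by have := hA 0 (by omega); simpa using this
  have hAm : A (p m) = true := (hA m le_rfl).2 (by omega)
  have hB0 : B (p 0) = true := (hB 0 (by omega)).2 (by omega)
  have hBm : B (p m) = false := by have := hB m le_rfl; simpa using this
  by_cases hmid : ∃ i, 1 ≤ i ∧ i + 2 ≤ m ∧ r i o ≠ r i w
  · -- a row through the middle of the path contains `o`
    obtain ⟨i, hi1, hi2, hio⟩ := hmid
    have h0 := h i (by omega) 0 (by omega)
    have h1 := h i (by omega) m (by omega)
    have h2 := h i (by omega) i (by omega)
    have hAi := (hA i (by omega)).2 (by omega)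
    have hBi := (hB i (by omega)).2 (by omega)
    refine HasStar.hasObstruction ⟨o, p 0, p m, p i, ⟨A, hAR, ?_⟩, ⟨B, hBR, ?_⟩, r i,
      hr i (by omega), ?_⟩
    · simp [Separates, *]
    · simp [Separates, *]
    · have h0' : ¬ (0 = i ∨ 0 = i + 1) := by omega
      have h1' : ¬ (m = i ∨ m = i + 1) := by omega
      simp only [Separates]
      clear h hA hB
      cases e : r i w <;> simp_all
  push Not at hmid
  by_cases hl : r 0 o = r 0 w
  · by_cases hlast : r (m - 1) o = r (m - 1) w
    · -- no row of the path contains `o`, which extends the cycle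
      have hall : ∀ i < m, r i o = r i w := by
        intro i hi
        by_cases h1 : i = 0
        · rw [h1, hl]
        by_cases h2 : i = m - 1
        · rw [h2, hlast]
        exact hmid i (by omega) (by omega)
      refine Or.inl ⟨m + 1, fun j => if j = m + 1 then o else p j, w,
        fun i => if i = m then B else r i, A, by omega, ?_, hAR, ?_, ?_⟩
      · intro i hi
        dsimp only
        split_ifs
        · exact hBR
        · exact hr i (by omega)
      · intro i hi j hj
        by_cases h1 : i = m <;> by_cases h2 : j = m + 1
        · simp [h1, h2, hBo, hBw]
        · have := hB j (by omega)
          simp only [h1, h2, if_true, if_false, hBw]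
          grind
        · have := hall i (by omega)
          simp only [h1, h2, if_true, if_false]
          grind
        · simp only [h1, h2, if_false]
          rw [h i (by omega) j (by omega)]
      · intro j hj
        by_cases h2 : j = m + 1
        · simp [h2, hAo, hAw]
        · have := hA j (by omega)
          simp only [h2, if_false, hAw]
          grind
    · -- `o` replaces `p m`
      refine Or.inl ⟨m, fun j => if j = m then o else p j, w, r, A, hm, hr, hAR, ?_, ?_⟩
      · intro i hi j hj
        by_cases h2 : j = m
        · simp only [h2, if_true]
          by_cases h3 : i = m - 1
          · subst h3
            simp only [ne_eq, hlast, not_false_eq_true, true_iff]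
            omega
          · have : r i o = r i w := by
              by_cases h1 : i = 0
              · rw [h1, hl]
              exact hmid i (by omega) (by omega)
            simp only [this, ne_eq, not_true_eq_false, false_iff]
            omega
        · simp only [h2, if_false]
          rw [h i hi j hj]
      · intro j hj
        by_cases h2 : j = m
        · simp [h2, hAo, hAw]
        · have := hA j (by omega)
          simp only [h2, if_false, hAw]
          grind
  · by_cases hlast : r (m - 1) o = r (m - 1) w
    · -- `o` replaces `p 0`
      refine Or.inl ⟨m, fun j => if j = 0 then o else p j, w, r, B, hm, hr, hBR, ?_, ?_⟩
      · intro i hi j hj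
        by_cases h2 : j = 0
        · simp only [h2, if_true]
          by_cases h3 : i = 0
          · subst h3
            simp [hl]
          · have : r i o = r i w := by
              by_cases h1 : i = m - 1
              · rw [h1, hlast]
              exact hmid i (by omega) (by omega)
            simp only [this, ne_eq, not_true_eq_false, false_iff]
            omega
        · simp only [h2, if_false]
          rw [h i hi j hj]
      · intro j hj
        by_cases h2 : j = 0
        · simp [h2, hBo, hBw]
        · have := hB j (by omega)
          simp only [h2, if_false, hBw]
          grind
    · by_cases hm2 : m = 2
      · -- a cycle of length four through `o`, `p 0`, `w`, `p 2`, seen from `p 1`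
        subst hm2
        have h00 := h 0 (by omega) 0 (by omega)
        have h01 := h 0 (by omega) 1 (by omega)
        have h02 := h 0 (by omega) 2 (by omega)
        have h10 := h 1 (by omega) 0 (by omega)
        have h11 := h 1 (by omega) 1 (by omega)
        have h12 := h 1 (by omega) 2 (by omega)
        have hA1 := hA 1 (by omega)
        have hB1 := hB 1 (by omega)
        simp at h00 h01 h02 h10 h11 h12 hA1 hB1 hlast
        refine Or.inl ⟨3, fun j => if j = 0 then o else if j = 1 then p 0 else if j = 2 then w
          else p 2, p 1, fun i => if i = 0 then A else if i = 1 then r 1 else r 0, B, by omega,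
          ?_, hBR, ?_, ?_⟩
        · intro i hi
          dsimp only
          split_ifs
          · exact hAR
          · exact hr 1 (by omega)
          · exact hr 0 (by omega)
        · intro i hi j hj
          interval_cases i <;> interval_cases j <;> simp [*] <;>
            cases e0 : r 0 w <;> cases e1 : r 1 w <;> simp_all
        · intro j hj
          interval_cases j <;> simp [*]
      · -- `o` short-cuts both `p 0` and `p m`
        refine Or.inl ⟨m - 1, fun j => if j = m - 1 then o else p (j + 1), w, fun i => r (i + 1),
          r 0, by omega, fun i hi => hr _ (by omega), hr 0 (by omega), ?_, ?_⟩
        · intro i hi j hj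
          by_cases h2 : j = m - 1
          · simp only [h2, if_true]
            by_cases h3 : i = m - 2
            · have h4 : i + 1 = m - 1 := by omega
              rw [h4]
              simp only [ne_eq, hlast, not_false_eq_true, or_true]
            · simp only [hmid (i + 1) (by omega) (by omega), ne_eq, not_true_eq_false, false_iff]
              omega
          · simp only [h2, if_false]
            rw [h _ (by omega) _ (by omega)]
            omega
        · intro j hj
          by_cases h2 : j = m - 1
          · simp [h2, hl]
          · simp only [h2, if_false, or_false]
            rw [h _ (by omega) _ (by omega)]
            omega

/-- A path of two-column rows from `p 0` to `p m`, together with a row containing the whole path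
but not `w` and `o`, and a row containing `w` and the ends of the path only. -/
theorem hasObstruction_of_path_of_cover {m : ℕ} {p : ℕ → X} {w o : X} {r : ℕ → X → Bool}
    {A B : X → Bool} (hm : 2 ≤ m) (hr : ∀ i < m, r i ∈ R) (hAR : A ∈ R) (hBR : B ∈ R)
    (h : ∀ i < m, ∀ j ≤ m, (r i (p j) ≠ r i w ↔ j = i ∨ j = i + 1))
    (hAw : A w = false) (hBw : B w = true) (hAo : A o = false) (hBo : B o = false)
    (hA : ∀ j ≤ m, A (p j) = true) (hB : ∀ j ≤ m, (B (p j) = true ↔ j = 0 ∨ j = m)) :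
    HasObstruction R := by
  have hA0 := hA 0 (by omega)
  have hA1 := hA 1 (by omega)
  have hAm := hA m le_rfl
  have hAm1 := hA (m - 1) (by omega)
  have hB0 : B (p 0) = true := (hB 0 (by omega)).2 (by omega)
  have hBm : B (p m) = true := (hB m le_rfl).2 (by omega)
  have hB1 : B (p 1) = false := by
    have := hB 1 (by omega)
    simpa [show ¬ (1 = m) by omega] using this
  have hBm1 : B (p (m - 1)) = false := by
    have := hB (m - 1) (by omega)
    simpa [show ¬ (m - 1 = m) by omega, show ¬ (m - 1 = 0) by omega] using this
  have h00 := h 0 (by omega) 0 (by omega)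
  have h01 := h 0 (by omega) 1 (by omega)
  have h0m := h 0 (by omega) m (by omega)
  have h0n := h 0 (by omega) (m - 1) (by omega)
  have hn0 := h (m - 1) (by omega) 0 (by omega)
  have hn1 := h (m - 1) (by omega) 1 (by omega)
  have hnm := h (m - 1) (by omega) m (by omega)
  have hnn := h (m - 1) (by omega) (m - 1) (by omega)
  by_cases hm2 : m = 2
  · subst hm2
    simp at h00 h01 h0m h0n hn0 hn1 hnm hnn hBm1
    by_cases g0 : r 0 o = r 0 w <;> by_cases g1 : r 1 o = r 1 w
    · refine HasStar.hasObstruction ⟨p 1, o, p 0, p 2, ⟨B, hBR, ?_⟩, ⟨r 0, hr 0 (by omega), ?_⟩,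
        r 1, hr 1 (by omega), ?_⟩ <;> clear h hA hB hr <;>
          cases e0 : r 0 w <;> cases e1 : r 1 w <;> simp_all [Separates]
    · -- a cycle of length four through `w`, `o`, `p 1`, `p 0`, seen from `p 2`
      refine Or.inl ⟨3, fun j => if j = 0 then w else if j = 1 then o else if j = 2 then p 1
        else p 0, p 2, fun i => if i = 0 then A else if i = 1 then B else r 0, r 1, by omega,
        ?_, hr 1 (by omega), ?_, ?_⟩
      · intro i hi
        dsimp only
        split_ifs
        · exact hAR
        · exact hBR
        · exact hr 0 (by omega)
      · intro i hi j hj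
        interval_cases i <;> interval_cases j <;> simp [*]
      · intro j hj
        interval_cases j <;> simp [*] <;>
          cases e0 : r 0 w <;> cases e1 : r 1 w <;> simp_all
    · -- the same with the two ends of the path exchanged
      refine Or.inl ⟨3, fun j => if j = 0 then w else if j = 1 then o else if j = 2 then p 1
        else p 2, p 0, fun i => if i = 0 then A else if i = 1 then B else r 1, r 0, by omega,
        ?_, hr 0 (by omega), ?_, ?_⟩
      · intro i hi
        dsimp only
        split_ifs
        · exact hAR
        · exact hBR
        · exact hr 1 (by omega)
      · intro i hi j hj
        interval_cases i <;> interval_cases j <;> simp [*]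
      · intro j hj
        interval_cases j <;> simp [*] <;>
          cases e0 : r 0 w <;> cases e1 : r 1 w <;> simp_all
    · refine HasStar.hasObstruction ⟨w, o, p 0, p 2, ⟨A, hAR, ?_⟩, ⟨r 1, hr 1 (by omega), ?_⟩,
        r 0, hr 0 (by omega), ?_⟩ <;> clear h hA hB hr <;>
          cases e0 : r 0 w <;> cases e1 : r 1 w <;> simp_all [Separates]
  have e1 : ¬ (m = 0 ∨ m = 0 + 1) := by omega
  have e2 : ¬ (m - 1 = 0 ∨ m - 1 = 0 + 1) := by omega
  have e3 : ¬ (0 = m - 1 ∨ 0 = m - 1 + 1) := by omega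
  have e4 : ¬ (1 = m - 1 ∨ 1 = m - 1 + 1) := by omega
  have e5 : m = m - 1 ∨ m = m - 1 + 1 := by omega
  simp only [e1, e2, e3, e4, e5, iff_true, iff_false, not_not, ne_eq, true_or,
    or_true, zero_add] at h00 h01 h0m h0n hn0 hn1 hnm hnn
  by_cases g0 : r 0 o = r 0 w
  · by_cases g1 : r (m - 1) o = r (m - 1) w
    · refine Or.inr ⟨p 0, p 1, p m, p (m - 1), w, o, r 0, r (m - 1), A, B, hr 0 (by omega),
        hr _ (by omega), hAR, hBR, ?_, ?_, ?_, ?_⟩ <;>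
        clear h hA hB hr e1 e2 e3 e4 e5 <;>
        cases e0 : r 0 w <;> cases e1 : r (m - 1) w <;> simp_all [CutsPair, CutsTriple]
    · refine HasStar.hasObstruction ⟨o, p m, w, p 1, ⟨r (m - 1), hr _ (by omega), ?_⟩,
        ⟨A, hAR, ?_⟩, B, hBR, ?_⟩ <;> clear h hA hB hr e1 e2 e3 e4 e5 <;>
        cases e0 : r 0 w <;> cases e1 : r (m - 1) w <;> simp_all [Separates]
  · refine HasStar.hasObstruction ⟨o, p 0, w, p (m - 1), ⟨r 0, hr _ (by omega), ?_⟩,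
      ⟨A, hAR, ?_⟩, B, hBR, ?_⟩ <;> clear h hA hB hr e1 e2 e3 e4 e5 <;>
        cases e0 : r 0 w <;> cases e1 : r (m - 1) w <;> simp_all [Separates]

/-- A path of two-column rows closed by a row `A` that misses an inner point of the path contains
a shorter cycle, closed by `A`. -/
theorem hasCycle_of_path_of_gap {m : ℕ} {p : ℕ → X} {w : X} {r : ℕ → X → Bool} {A : X → Bool}
    (hr : ∀ i < m, r i ∈ R) (hAR : A ∈ R)
    (h : ∀ i < m, ∀ j ≤ m, (r i (p j) ≠ r i w ↔ j = i ∨ j = i + 1))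
    (hAw : A w = false) (hA0 : A (p 0) = true) (hAm : A (p m) = true) {j : ℕ} (hj : j ≤ m)
    (hAj : A (p j) = false) : HasCycle R := by
  -- the last point before `j` and the first point after `j` in the row `A`
  obtain ⟨a, haj, haA, hamax⟩ : ∃ a ≤ j, A (p a) = true ∧ ∀ i, a < i → i ≤ j → A (p i) = false := by
    refine ⟨Nat.findGreatest (fun i => A (p i) = true) j, Nat.findGreatest_le _,
      Nat.findGreatest_spec (P := fun i => A (p i) = true) (Nat.zero_le j) hA0, fun i h1 h2 => ?_⟩
    simpa using Nat.findGreatest_is_greatest h1 h2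
  have hex : ∃ b, j ≤ b ∧ A (p b) = true := ⟨m, hj, hAm⟩
  obtain ⟨b, hjb, hbA, hbm, hbmin⟩ : ∃ b, j ≤ b ∧ A (p b) = true ∧ b ≤ m ∧
      ∀ i, j ≤ i → i < b → A (p i) = false := by
    refine ⟨Nat.find hex, (Nat.find_spec hex).1, (Nat.find_spec hex).2,
      Nat.find_min' hex ⟨hj, hAm⟩, fun i h1 h2 => ?_⟩
    have := Nat.find_min hex h2
    simpa [h1] using this
  have haj' : a ≠ j := by rintro rfl; simp [hAj] at haA
  have hjb' : b ≠ j := by rintro rfl; simp [hAj] at hbA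
  refine ⟨b - a, fun i => p (a + i), w, fun i => r (a + i), A, by omega,
    fun i hi => hr _ (by omega), hAR, ?_, ?_⟩
  · intro i hi k hk
    rw [h _ (by omega) _ (by omega)]
    omega
  · intro i hi
    rw [hAw]
    by_cases h1 : i = 0
    · simp [h1, haA]
    by_cases h2 : i = b - a
    · rw [h2, show a + (b - a) = b by omega]
      simp [hbA]
    have : A (p (a + i)) = false := by
      by_cases h3 : a + i ≤ j
      · exact hamax _ (by omega) h3
      · exact hbmin _ (by omega) (by omega)
    simp [this, h1, h2]

/-- If the closing row of a cycle is the intersection of two rows of `R` not covering all columns,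
then `R` has an obstruction. -/
theorem hasObstruction_of_cycle_and {A B : X → Bool} (hAR : A ∈ R) (hBR : B ∈ R) {o : X}
    (hAo : A o = false) (hBo : B o = false) {m : ℕ} {p : ℕ → X} {w : X} {r : ℕ → X → Bool}
    (hm : 2 ≤ m) (hr : ∀ i < m, r i ∈ R) (h : IsCycleOn m p w r (fun x => A x && B x)) :
    HasObstruction R := by
  obtain ⟨h, hE⟩ := h
  cases hw : (A w && B w)
  · -- both ends of the path are in `A ∩ B`
    simp only [hw, ne_eq, Bool.not_eq_false, Bool.and_eq_true] at hE
    have key : ∀ A B : X → Bool, A ∈ R → B ∈ R → A o = false → B o = false → A w = false →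
        (∀ j ≤ m, (A (p j) = true ∧ B (p j) = true ↔ j = 0 ∨ j = m)) → HasObstruction R := by
      intro A B hAR hBR hAo hBo hAw hE
      obtain ⟨hA0, hB0⟩ := (hE 0 (by omega)).2 (Or.inl rfl)
      obtain ⟨hAm, hBm⟩ := (hE m le_rfl).2 (Or.inr rfl)
      by_cases hgap : ∃ j ≤ m, A (p j) = false
      · obtain ⟨j, hj, hAj⟩ := hgap
        exact Or.inl (hasCycle_of_path_of_gap hr hAR h hAw hA0 hAm hj hAj)
      have hA : ∀ j ≤ m, A (p j) = true := fun j hj => by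
        by_contra hcon
        exact hgap ⟨j, hj, by simpa using hcon⟩
      have hB : ∀ j ≤ m, (B (p j) = true ↔ j = 0 ∨ j = m) := fun j hj => by
        rw [← hE j hj]
        simp [hA j hj]
      cases hBw : B w
      · refine Or.inl ⟨m, p, w, r, B, hm, hr, hBR, h, fun j hj => ?_⟩
        rw [← hB j hj, hBw]
        simp
      · exact hasObstruction_of_path_of_cover hm hr hAR hBR h hAw hBw hAo hBo hA hB
    rcases Bool.and_eq_false_iff.1 hw with hw | hw
    · exact key A B hAR hBR hAo hBo hw hE
    · exact key B A hBR hAR hBo hAo hw fun j hj => by rw [and_comm, hE j hj]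
  · -- both ends of the path are outside `A ∩ B`
    obtain ⟨hAw, hBw⟩ := Bool.and_eq_true_iff.1 hw
    simp only [hw, ne_eq, Bool.not_eq_true, Bool.and_eq_false_iff] at hE
    have hin : ∀ j ≤ m, j ≠ 0 → j ≠ m → A (p j) = true ∧ B (p j) = true := by
      intro j hj h0 h1
      have := hE j hj
      grind
    have h0 := (hE 0 (by omega)).2 (Or.inl rfl)
    have h1 := (hE m le_rfl).2 (Or.inr rfl)
    have key : ∀ A : X → Bool, A ∈ R → A w = true →
        (∀ j ≤ m, j ≠ 0 → j ≠ m → A (p j) = true) → A (p 0) = false → A (p m) = false →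
        HasObstruction R := by
      intro A hAR hAw hin h0 h1
      refine Or.inl ⟨m, p, w, r, A, hm, hr, hAR, h, fun j hj => ?_⟩
      by_cases e0 : j = 0
      · simp [e0, h0, hAw]
      by_cases e1 : j = m
      · simp [e1, h1, hAw]
      · simp [hin j hj e0 e1, e0, e1, hAw]
    cases hA0 : A (p 0) <;> cases hAm : A (p m)
    · exact key A hAR hAw (fun j hj a b => (hin j hj a b).1) hA0 hAm
    · cases hB0 : B (p 0)
      · exact key B hBR hBw (fun j hj a b => (hin j hj a b).2) hB0 (by grind)
      · refine hasObstruction_of_path_of_pairs hm hr hAR hBR h hAw hBw hAo hBo ?_ ?_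
        · intro j hj
          by_cases e0 : j = 0
          · simp [e0, hA0]
          by_cases e1 : j = m
          · simp [e1, hAm]; omega
          · simp [hin j hj e0 e1, e0]
        · intro j hj
          by_cases e0 : j = 0
          · simp [e0, hB0]; omega
          by_cases e1 : j = m
          · simp [e1]; grind
          · simp [hin j hj e0 e1, e1]
    · cases hBm : B (p m)
      · exact key B hBR hBw (fun j hj a b => (hin j hj a b).2) (by grind) hBm
      · refine hasObstruction_of_path_of_pairs hm hr hBR hAR h hBw hAw hBo hAo ?_ ?_
        · intro j hj
          by_cases e0 : j = 0
          · simp [e0]; grind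
          by_cases e1 : j = m
          · simp [e1, hBm]; omega
          · simp [hin j hj e0 e1, e0]
        · intro j hj
          by_cases e0 : j = 0
          · simp [e0, hA0]; omega
          by_cases e1 : j = m
          · simp [e1, hAm]
          · simp [hin j hj e0 e1, e1]
    · exact key B hBR hBw (fun j hj a b => (hin j hj a b).2) (by grind) (by grind)

end

/-! ### Intersections creating transversal configurations -/

section
variable {X : Type*} {R : Set (X → Bool)} {a₁ a₂ b₁ b₂ c₁ c₂ o : X} {A B C T P Q : X → Bool}

theorem IsTransversalOn.cycle (h : IsTransversalOn a₁ a₂ b₁ b₂ c₁ c₂ A B C T) :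
    IsTransversalOn b₁ b₂ c₁ c₂ a₁ a₂ B C A T := by
  refine ⟨h.snd, h.trd, h.fst, ?_⟩
  obtain ⟨h1, h2, h3, h4, h5⟩ := h.transversal
  exact ⟨by rw [h2, h1], h1.symm, by rw [h4, h3], h3.symm, by rw [h1, h3]; exact h5⟩

theorem IsTransversalOn.flip (h : IsTransversalOn a₁ a₂ b₁ b₂ c₁ c₂ A B C T) :
    IsTransversalOn a₂ a₁ b₂ b₁ c₂ c₁ A B C T := by
  obtain ⟨⟨x1, x2, x3, x4, x5⟩, ⟨y1, y2, y3, y4, y5⟩, ⟨z1, z2, z3, z4, z5⟩,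
    t1, t2, t3, t4, t5⟩ := h
  constructor <;> simp_all [CutsPair, CutsTriple, eq_comm]

theorem IsTransversalOn.swap (h : IsTransversalOn a₁ a₂ b₁ b₂ c₁ c₂ A B C T) :
    IsTransversalOn a₁ a₂ c₁ c₂ b₁ b₂ A C B T := by
  obtain ⟨⟨x1, x2, x3, x4, x5⟩, ⟨y1, y2, y3, y4, y5⟩, ⟨z1, z2, z3, z4, z5⟩,
    t1, t2, t3, t4, t5⟩ := h
  constructor <;> simp_all [CutsPair, CutsTriple]

theorem IsTransversalOn.ne (h : IsTransversalOn a₁ a₂ b₁ b₂ c₁ c₂ A B C T) :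
    B ≠ A ∧ C ≠ A ∧ T ≠ A := by
  obtain ⟨⟨x1, x2, x3, x4, x5⟩, ⟨y1, y2, y3, y4, y5⟩, ⟨z1, z2, z3, z4, z5⟩,
    t1, t2, t3, t4, t5⟩ := h
  refine ⟨?_, ?_, ?_⟩ <;> rintro rfl <;> simp_all

/-- A row containing `a₂` and `b₁` but neither `b₂` nor `c₁` completes a star. -/
theorem hasStar_of_cross (h : IsTransversalOn a₁ a₂ b₁ b₂ c₁ c₂ A B C T) (hB : B ∈ R)
    (hT : T ∈ R) (hP : P ∈ R) (h1 : P a₂ = true) (h2 : P b₁ = true) (h3 : P b₂ = false)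
    (h4 : P c₁ = false) : HasStar R := by
  obtain ⟨y1, y2, y3, y4, y5⟩ := h.snd
  obtain ⟨t1, t2, t3, t4, t5⟩ := h.transversal
  refine ⟨b₁, a₂, b₂, c₁, ⟨P, hP, ?_⟩, ⟨B, hB, ?_⟩, T, hT, ?_⟩ <;> simp_all [Separates]

/-- The column `o` and the rows `P = a₁a₂b₁b₂`, `Q = a₁a₂c₁c₂`. -/
theorem hasStar_of_blocks (h : IsTransversalOn a₁ a₂ b₁ b₂ c₁ c₂ A B C T) (hT : T ∈ R)
    (hP : P ∈ R) (hQ : Q ∈ R) (hPo : P o = false) (hQo : Q o = false)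
    (hPa₁ : P a₁ = true) (hPa₂ : P a₂ = true) (hQa₁ : Q a₁ = true) (hQa₂ : Q a₂ = true)
    (hPv : P b₁ = true ∧ P b₂ = true ∧ P c₁ = false ∧ P c₂ = false)
    (hQv : Q b₁ = false ∧ Q b₂ = false ∧ Q c₁ = true ∧ Q c₂ = true) : HasStar R := by
  obtain ⟨t1, t2, t3, t4, t5⟩ := h.transversal
  by_cases hTo : T o = T a₁
  · refine ⟨o, c₂, b₂, a₁, ⟨P, hP, ?_⟩, ⟨Q, hQ, ?_⟩, T, hT, ?_⟩ <;> simp_all [Separates]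
  · refine ⟨o, c₁, b₁, a₂, ⟨P, hP, ?_⟩, ⟨Q, hQ, ?_⟩, T, hT, ?_⟩ <;>
      cases e : T a₁ <;> simp_all [Separates]

/-- The column `o` and the rows `P = a₁a₂b₁c₁`, `Q = a₁a₂b₂c₂`, where `T` has `o` on the side of
`a₁`. -/
theorem hasStar_of_sides (h : IsTransversalOn a₁ a₂ b₁ b₂ c₁ c₂ A B C T) (hB : B ∈ R)
    (hC : C ∈ R) (hT : T ∈ R) (hP : P ∈ R) (hPo : P o = false) (hPa₂ : P a₂ = true)
    (hTo : T o = T a₁) (hPv : P b₁ = true ∧ P b₂ = false ∧ P c₁ = true ∧ P c₂ = false) :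
    HasStar R := by
  obtain ⟨y1, y2, y3, y4, y5⟩ := h.snd
  obtain ⟨z1, z2, z3, z4, z5⟩ := h.trd
  obtain ⟨t1, t2, t3, t4, t5⟩ := h.transversal
  have t6 := t5.symm
  by_cases hBo : B o = B b₁
  · by_cases hCo : C o = C c₁
    · refine ⟨o, b₂, c₂, a₁, ⟨B, hB, ?_⟩, ⟨C, hC, ?_⟩, T, hT, ?_⟩ <;> simp_all [Separates]
    · refine ⟨c₂, o, c₁, a₂, ⟨P, hP, ?_⟩, ⟨C, hC, ?_⟩, T, hT, ?_⟩ <;>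
        cases e : C c₁ <;> simp_all [Separates]
  · refine ⟨b₂, o, b₁, a₂, ⟨P, hP, ?_⟩, ⟨B, hB, ?_⟩, T, hT, ?_⟩ <;>
      cases e : B b₁ <;> simp_all [Separates]

/-- If a pair row of a transversal configuration is the intersection of two rows of `R` not
covering all columns, then `R` has an obstruction. -/
theorem hasObstruction_of_pair_and (hP : P ∈ R) (hQ : Q ∈ R) (hPo : P o = false)
    (hQo : Q o = false) (hB : B ∈ R) (hC : C ∈ R) (hT : T ∈ R)
    (h : IsTransversalOn a₁ a₂ b₁ b₂ c₁ c₂ (fun x => P x && Q x) B C T) : HasObstruction R := by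
  obtain ⟨x1, x2, x3, x4, x5⟩ := h.fst
  have hdirect : ∀ P ∈ R, CutsPair P a₁ a₂ b₁ b₂ c₁ c₂ → HasObstruction R := fun P hP hcut =>
    Or.inr ⟨a₁, a₂, b₁, b₂, c₁, c₂, P, B, C, T, hP, hB, hC, hT, hcut, h.snd, h.trd,
      h.transversal⟩
  by_contra hno
  have hnostar : ¬ HasStar R := fun hs => hno hs.hasObstruction
  cases hD : (P a₁ && Q a₁)
  · -- the pair `a₁`, `a₂` is outside `P ∩ Q`
    have hb₁ : P b₁ = true ∧ Q b₁ = true := by simpa [hD] using x5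
    have hb₂ : P b₂ = true ∧ Q b₂ = true := by simpa [hb₁] using x2
    have hc₁ : P c₁ = true ∧ Q c₁ = true := by simpa [hb₁] using x3
    have hc₂ : P c₂ = true ∧ Q c₂ = true := by simpa [hb₁] using x4
    have key : ∀ P ∈ R, ∀ Q ∈ R, P o = false → Q o = false → (P b₁ = true ∧ Q b₁ = true) →
        (P b₂ = true ∧ Q b₂ = true) → (P c₁ = true ∧ Q c₁ = true) → (P c₂ = true ∧ Q c₂ = true) →
        P a₁ = false → P a₂ = true → Q a₁ = true → Q a₂ = false → False := by
      intro P hP Q hQ hPo hQo hb₁ hb₂ hc₁ hc₂ hP1 hP2 hQ1 hQ2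
      obtain ⟨y1, y2, y3, y4, y5⟩ := h.snd
      obtain ⟨z1, z2, z3, z4, z5⟩ := h.trd
      obtain ⟨t1, t2, t3, t4, t5⟩ := h.transversal
      by_cases hBo : B o = B b₁
      · refine hnostar ⟨o, a₁, a₂, b₁, ⟨P, hP, ?_⟩, ⟨Q, hQ, ?_⟩, B, hB, ?_⟩ <;>
          simp_all [Separates]
      by_cases hCo : C o = C c₁
      · refine hnostar ⟨o, a₁, a₂, c₁, ⟨P, hP, ?_⟩, ⟨Q, hQ, ?_⟩, C, hC, ?_⟩ <;>
          simp_all [Separates]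
      -- `o` takes the place of `a₁` or of `a₂`
      by_cases hTo : T o = T a₁
      · refine hno (Or.inr ⟨o, a₂, b₁, b₂, c₁, c₂, Q, B, C, T, hQ, hB, hC, hT, ?_, ?_, ?_, ?_⟩) <;>
          cases e0 : B b₁ <;> cases e1 : C c₁ <;> simp_all [CutsPair, CutsTriple]
      · refine hno (Or.inr ⟨a₁, o, b₁, b₂, c₁, c₂, P, B, C, T, hP, hB, hC, hT, ?_, ?_, ?_, ?_⟩) <;>
          cases e0 : B b₁ <;> cases e1 : C c₁ <;> cases e2 : T a₁ <;>
          simp_all [CutsPair, CutsTriple]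
    cases hP1 : P a₁ <;> cases hP2 : P a₂
    · exact hno (hdirect P hP (by simp [CutsPair, *]))
    · cases hQ1 : Q a₁ <;> cases hQ2 : Q a₂
      · exact hno (hdirect Q hQ (by simp [CutsPair, *]))
      · simp [*] at x1
      · exact key P hP Q hQ hPo hQo hb₁ hb₂ hc₁ hc₂ hP1 hP2 hQ1 hQ2
      · simp [*] at x1
    · cases hQ1 : Q a₁ <;> cases hQ2 : Q a₂
      · exact hno (hdirect Q hQ (by simp [CutsPair, *]))
      · exact key Q hQ P hP hQo hPo hb₁.symm hb₂.symm hc₁.symm hc₂.symm hQ1 hQ2 hP1 hP2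
      · simp [*] at x1
      · simp [*] at x1
    · exact hno (hdirect Q hQ (by simp_all [CutsPair]))
  · -- the pair `a₁`, `a₂` is inside `P ∩ Q`
    obtain ⟨hP1, hQ1⟩ := Bool.and_eq_true_iff.1 hD
    obtain ⟨hP2, hQ2⟩ : P a₂ = true ∧ Q a₂ = true := by simpa [hP1, hQ1] using x1.symm
    have hb₁ : (P b₁ && Q b₁) = false := by simpa [hD] using x5.symm
    have hb₂ : (P b₂ && Q b₂) = false := x2.symm.trans hb₁
    have hc₁ : (P c₁ && Q c₁) = false := x3.trans hb₁
    have hc₂ : (P c₂ && Q c₂) = false := x4.trans hb₁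
    have hcross : ∀ P ∈ R, P a₁ = true → P a₂ = true →
        ¬ (P b₁ = true ∧ P b₂ = false ∧ P c₁ = false) ∧
        ¬ (P b₂ = true ∧ P b₁ = false ∧ P c₂ = false) ∧
        ¬ (P c₁ = true ∧ P c₂ = false ∧ P b₁ = false) ∧
        ¬ (P c₂ = true ∧ P c₁ = false ∧ P b₂ = false) := fun P hP h1 h2 =>
      ⟨fun hc => hnostar (hasStar_of_cross h hB hT hP h2 hc.1 hc.2.1 hc.2.2),
        fun hc => hnostar (hasStar_of_cross h.flip hB hT hP h1 hc.1 hc.2.1 hc.2.2),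
        fun hc => hnostar (hasStar_of_cross h.swap hC hT hP h2 hc.1 hc.2.1 hc.2.2),
        fun hc => hnostar (hasStar_of_cross h.flip.swap hC hT hP h1 hc.1 hc.2.1 hc.2.2)⟩
    have hcases : (P b₁ = false ∧ P b₂ = false ∧ P c₁ = false ∧ P c₂ = false) ∨
        (Q b₁ = false ∧ Q b₂ = false ∧ Q c₁ = false ∧ Q c₂ = false) ∨
        ((P b₁ = true ∧ P b₂ = true ∧ P c₁ = false ∧ P c₂ = false) ∧
          Q b₁ = false ∧ Q b₂ = false ∧ Q c₁ = true ∧ Q c₂ = true) ∨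
        ((Q b₁ = true ∧ Q b₂ = true ∧ Q c₁ = false ∧ Q c₂ = false) ∧
          P b₁ = false ∧ P b₂ = false ∧ P c₁ = true ∧ P c₂ = true) ∨
        ((P b₁ = true ∧ P b₂ = false ∧ P c₁ = true ∧ P c₂ = false) ∧
          Q b₁ = false ∧ Q b₂ = true ∧ Q c₁ = false ∧ Q c₂ = true) ∨
        ((Q b₁ = true ∧ Q b₂ = false ∧ Q c₁ = true ∧ Q c₂ = false) ∧
          P b₁ = false ∧ P b₂ = true ∧ P c₁ = false ∧ P c₂ = true) := by
      have hcP := hcross P hP hP1 hP2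
      have hcQ := hcross Q hQ hQ1 hQ2
      clear hcross
      revert hcP hcQ hb₁ hb₂ hc₁ hc₂
      generalize P b₁ = p1, P b₂ = p2, P c₁ = p3, P c₂ = p4,
        Q b₁ = q1, Q b₂ = q2, Q c₁ = q3, Q c₂ = q4
      clear * -
      revert p1 p2 p3 p4 q1 q2 q3 q4
      set_option synthInstance.maxSize 2000 in decide
    have hsides : ∀ P ∈ R, ∀ Q ∈ R, P o = false → Q o = false → P a₂ = true → Q a₁ = true →
        ((P b₁ = true ∧ P b₂ = false ∧ P c₁ = true ∧ P c₂ = false) ∧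
          Q b₁ = false ∧ Q b₂ = true ∧ Q c₁ = false ∧ Q c₂ = true) → False := by
      intro P hP Q hQ hPo hQo hP2 hQ1 ⟨hPv, q1, q2, q3, q4⟩
      by_cases hTo : T o = T a₁
      · exact hnostar (hasStar_of_sides h hB hC hT hP hPo hP2 hTo hPv)
      · have hTo' : T o = T a₂ := by
          obtain ⟨-, -, -, -, t5⟩ := h.transversal
          revert hTo t5
          cases T o <;> cases T a₁ <;> cases T a₂ <;> simp
        exact hnostar (hasStar_of_sides h.flip hB hC hT hQ hQo hQ1 hTo' ⟨q2, q1, q4, q3⟩)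
    rcases hcases with hc | hc | hc | hc | hc | hc
    · exact hno (hdirect P hP (by simp [CutsPair, hc, hP1, hP2]))
    · exact hno (hdirect Q hQ (by simp [CutsPair, hc, hQ1, hQ2]))
    · exact hnostar (hasStar_of_blocks h hT hP hQ hPo hQo hP1 hP2 hQ1 hQ2 hc.1 hc.2)
    · exact hnostar (hasStar_of_blocks h hT hQ hP hQo hPo hQ1 hQ2 hP1 hP2 hc.1 hc.2)
    · exact hsides P hP Q hQ hPo hQo hP2 hQ1 hc
    · exact hsides Q hQ P hP hQo hPo hQ2 hP1 hc

/-- `P` contains `b₁`, `b₂`, `c₁`, `c₂` but not `a₂`, `Q` contains `a₂`, `b₁`, `c₁` but not `b₂`,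
`c₂`, and neither contains `o`. Unless there is a star, this is a transversal configuration in which
`a₂`, `o` play the part of the first pair, `P` that of its row, and `Q` that of the transversal
row. -/
theorem hasObstruction_of_shifted_triple (hP : P ∈ R) (hQ : Q ∈ R) (hPo : P o = false)
    (hQo : Q o = false) (hB : B ∈ R) (hC : C ∈ R)
    (hBcut : CutsPair B b₁ b₂ c₁ c₂ a₁ a₂) (hCcut : CutsPair C c₁ c₂ a₁ a₂ b₁ b₂)
    (hb₁ : P b₁ = true ∧ Q b₁ = true) (hc₁ : P c₁ = true ∧ Q c₁ = true)
    (ha₂ : P a₂ = false ∧ Q a₂ = true) (hb₂ : P b₂ = true ∧ Q b₂ = false)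
    (hc₂ : P c₂ = true ∧ Q c₂ = false) : HasObstruction R := by
  obtain ⟨y1, y2, y3, y4, y5⟩ := hBcut
  obtain ⟨z1, z2, z3, z4, z5⟩ := hCcut
  by_cases hBo : B o = B b₁
  · refine HasStar.hasObstruction ⟨o, a₂, b₁, c₂, ⟨P, hP, ?_⟩, ⟨B, hB, ?_⟩, Q, hQ, ?_⟩ <;>
      simp_all [Separates]
  by_cases hCo : C o = C c₁
  · refine HasStar.hasObstruction ⟨o, a₂, c₁, b₂, ⟨P, hP, ?_⟩, ⟨C, hC, ?_⟩, Q, hQ, ?_⟩ <;>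
      simp_all [Separates]
  refine Or.inr ⟨a₂, o, b₁, b₂, c₁, c₂, P, B, C, Q, hP, hB, hC, hQ, ?_, ?_, ?_, ?_⟩ <;>
    cases e0 : B b₁ <;> cases e1 : C c₁ <;> simp_all [CutsPair, CutsTriple]

/-- If the transversal row of a transversal configuration is the intersection of two rows of `R`
not covering all columns, then `R` has an obstruction. -/
theorem hasObstruction_of_triple_and (hP : P ∈ R) (hQ : Q ∈ R) (hPo : P o = false)
    (hQo : Q o = false) (hA : A ∈ R) (hB : B ∈ R) (hC : C ∈ R)
    (h : IsTransversalOn a₁ a₂ b₁ b₂ c₁ c₂ A B C (fun x => P x && Q x)) : HasObstruction R := by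
  have key : ∀ {a₁ a₂ b₁ b₂ c₁ c₂ : X},
      IsTransversalOn a₁ a₂ b₁ b₂ c₁ c₂ A B C (fun x => P x && Q x) →
      (P a₁ && Q a₁) = true → HasObstruction R := by
    intro a₁ a₂ b₁ b₂ c₁ c₂ h hD
    have hdirect : ∀ P ∈ R, CutsTriple P a₁ a₂ b₁ b₂ c₁ c₂ → HasObstruction R := fun P hP hcut =>
      Or.inr ⟨a₁, a₂, b₁, b₂, c₁, c₂, A, B, C, P, hA, hB, hC, hP, h.fst, h.snd, h.trd, hcut⟩
    have hA' := h.fst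
    have hB' := h.snd
    have hC' := h.trd
    obtain ⟨t1, t2, t3, t4, t5⟩ := h.transversal
    have ha₁ : P a₁ = true ∧ Q a₁ = true := by simpa using hD
    have hb₁ : P b₁ = true ∧ Q b₁ = true := by simpa [hD] using t1
    have hc₁ : P c₁ = true ∧ Q c₁ = true := by simpa [hD] using t2
    have ha₂ : (P a₂ && Q a₂) = false := by simpa [hD] using t5.symm
    have hb₂ : (P b₂ && Q b₂) = false := t3.trans ha₂
    have hc₂ : (P c₂ && Q c₂) = false := t4.trans ha₂
    -- two columns in exactly one of `P` and `Q` each, and a third in neither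
    have hstar : ∀ P ∈ R, ∀ Q ∈ R, ∀ C ∈ R, ∀ {a₁ a₂ b₁ b₂ c₁ c₂ : X},
        CutsPair C c₁ c₂ a₁ a₂ b₁ b₂ → P c₁ = true → Q c₁ = true → P a₂ = true → Q a₂ = false →
        P b₂ = false → Q b₂ = true → P c₂ = false → Q c₂ = false → HasObstruction R := by
      intro P hP Q hQ C hC a₁ a₂ b₁ b₂ c₁ c₂ hcut p1 p2 p3 p4 p5 p6 p7 p8
      obtain ⟨z1, z2, z3, z4, z5⟩ := hcut
      refine HasStar.hasObstruction ⟨c₂, a₂, b₂, c₁, ⟨Q, hQ, ?_⟩, ⟨P, hP, ?_⟩, C, hC, ?_⟩ <;>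
        simp_all [Separates]
    cases pa : P a₂ <;> cases pb : P b₂ <;> cases pc : P c₂ <;>
    cases qa : Q a₂ <;> cases qb : Q b₂ <;> cases qc : Q c₂ <;>
    first
    | (exfalso; simp [pa, pb, pc, qa, qb, qc] at ha₂ hb₂ hc₂; done)
    | exact hdirect P hP ⟨hb₁.1.trans ha₁.1.symm, hc₁.1.trans ha₁.1.symm, pb.trans pa.symm,
        pc.trans pa.symm, fun e => Bool.false_ne_true (pa.symm.trans (e.symm.trans ha₁.1))⟩
    | exact hdirect Q hQ ⟨hb₁.2.trans ha₁.2.symm, hc₁.2.trans ha₁.2.symm, qb.trans qa.symm,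
        qc.trans qa.symm, fun e => Bool.false_ne_true (qa.symm.trans (e.symm.trans ha₁.2))⟩
    | exact hstar P hP Q hQ C hC hC' hc₁.1 hc₁.2 pa qa pb qb pc qc
    | exact hstar Q hQ P hP C hC hC' hc₁.2 hc₁.1 qa pa qb pb qc pc
    | exact hstar P hP Q hQ A hA hA' ha₁.1 ha₁.2 pb qb pc qc pa qa
    | exact hstar Q hQ P hP A hA hA' ha₁.2 ha₁.1 qb pb qc pc qa pa
    | exact hstar P hP Q hQ B hB hB' hb₁.1 hb₁.2 pc qc pa qa pb qb
    | exact hstar Q hQ P hP B hB hB' hb₁.2 hb₁.1 qc pc qa pa qb pb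
    | exact hasObstruction_of_shifted_triple hP hQ hPo hQo hB hC hB' hC' hb₁ hc₁ ⟨pa, qa⟩
        ⟨pb, qb⟩ ⟨pc, qc⟩
    | exact hasObstruction_of_shifted_triple hQ hP hQo hPo hB hC hB' hC' hb₁.symm hc₁.symm
        ⟨qa, pa⟩ ⟨qb, pb⟩ ⟨qc, pc⟩
    | exact hasObstruction_of_shifted_triple hP hQ hPo hQo hC hA hC' hA' hc₁ ha₁ ⟨pb, qb⟩
        ⟨pc, qc⟩ ⟨pa, qa⟩
    | exact hasObstruction_of_shifted_triple hQ hP hQo hPo hC hA hC' hA' hc₁.symm ha₁.symm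
        ⟨qb, pb⟩ ⟨qc, pc⟩ ⟨qa, pa⟩
    | exact hasObstruction_of_shifted_triple hP hQ hPo hQo hA hB hA' hB' ha₁ hb₁ ⟨pc, qc⟩
        ⟨pa, qa⟩ ⟨pb, qb⟩
    | exact hasObstruction_of_shifted_triple hQ hP hQo hPo hA hB hA' hB' ha₁.symm hb₁.symm
        ⟨qc, pc⟩ ⟨qa, pa⟩ ⟨qb, pb⟩
  cases hD : (P a₁ && Q a₁)
  · refine key h.flip ?_
    obtain ⟨-, -, -, -, t5⟩ := h.transversal
    simpa [hD] using t5.symm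
  · exact key h hD

/-! ### Families without obstructions -/

/-- Adding the intersection of two rows that do not cover all columns creates no obstruction. -/
theorem hasObstruction_of_insert_and (hP : P ∈ R) (hQ : Q ∈ R) (hPo : P o = false)
    (hQo : Q o = false) (h : HasObstruction (insert (fun x => P x && Q x) R)) :
    HasObstruction R := by
  rcases h with h | ⟨a₁, a₂, b₁, b₂, c₁, c₂, A, B, C, T, hA, hB, hC, hT, h⟩
  · rcases hasCycle_insert h with h | ⟨m, p, w, r, hm, hr, h⟩
    · exact Or.inl h
    · exact hasObstruction_of_cycle_and hP hQ hPo hQo hm hr h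
  have key : ∀ {a₁ a₂ b₁ b₂ c₁ c₂ : X} {B C T : X → Bool}, B ∈ insert (fun x => P x && Q x) R →
      C ∈ insert (fun x => P x && Q x) R → T ∈ insert (fun x => P x && Q x) R →
      IsTransversalOn a₁ a₂ b₁ b₂ c₁ c₂ (fun x => P x && Q x) B C T → HasObstruction R :=
    fun hB hC hT h => hasObstruction_of_pair_and hP hQ hPo hQo (hB.resolve_left h.ne.1)
      (hC.resolve_left h.ne.2.1) (hT.resolve_left h.ne.2.2) h
  rcases hA with rfl | hA
  · exact key hB hC hT h
  rcases hB with rfl | hB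
  · exact key hC (Or.inr hA) hT h.cycle
  rcases hC with rfl | hC
  · exact key (Or.inr hA) (Or.inr hB) hT h.cycle.cycle
  rcases hT with rfl | hT
  · exact hasObstruction_of_triple_and hP hQ hPo hQo hA hB hC h
  · exact Or.inr ⟨a₁, a₂, b₁, b₂, c₁, c₂, A, B, C, T, hA, hB, hC, hT, h⟩

/-- Obstructions are inherited from subfamilies of rows and from subsets (or blow-ups) of columns,
and they depend on the rows up to complementation only. -/
theorem HasObstruction.of_map {Y : Type*} {R' : Set (Y → Bool)} (τ : Y → X)
    (hR : ∀ C ∈ R', ∃ D ∈ R, ∀ x y, D (τ x) = D (τ y) ↔ C x = C y) (h : HasObstruction R') :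
    HasObstruction R := by
  choose! g hg hgC using hR
  rcases h with ⟨m, p, w, r, E, hm, hr, hE, h⟩ | ⟨a₁, a₂, b₁, b₂, c₁, c₂, A, B, C, T, hA, hB, hC,
    hT, h⟩
  · refine Or.inl ⟨m, fun j => τ (p j), τ w, fun i => g (r i), g E, hm,
      fun i hi => hg _ (hr i hi), hg _ hE, ?_, ?_⟩
    · intro i hi j hj
      rw [← h.row i hi j hj, not_iff_not, hgC _ (hr i hi)]
    · intro j hj
      rw [← h.closing j hj, not_iff_not, hgC _ hE]
  · obtain ⟨h1, h2, h3, h4⟩ := h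
    refine Or.inr ⟨τ a₁, τ a₂, τ b₁, τ b₂, τ c₁, τ c₂, g A, g B, g C, g T, hg _ hA, hg _ hB,
      hg _ hC, hg _ hT, ?_, ?_, ?_, ?_⟩ <;>
    simpa only [CutsPair, CutsTriple, ne_eq, hgC _ hA, hgC _ hB, hgC _ hC, hgC _ hT]

/-- A family of rows without obstructions has a common circular arrangement: enlarge it to a
maximal family without obstructions, which is then closed under complements and intersections. -/
theorem exists_arrangement_of_not_hasObstruction [Fintype X] (h : ¬ HasObstruction R) :
    ∃ f : X → ℤ, Function.Injective f ∧ ∀ C ∈ R, IsArcOn f Finset.univ C := by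
  obtain ⟨S, hRS, hS⟩ := Finite.exists_le_maximal (p := fun S : Set (X → Bool) =>
    ¬ HasObstruction S) h
  have hmem : ∀ D : X → Bool, ¬ HasObstruction (insert D S) → D ∈ S := fun D hD =>
    hS.2 hD (Set.subset_insert D S) (Set.mem_insert D S)
  have hnot : ∀ A ∈ S, (fun x => !A x) ∈ S := by
    intro A hA
    refine hmem _ fun hobs => hS.1 (hobs.of_map id fun C hC => ?_)
    rcases hC with rfl | hC
    · exact ⟨A, hA, by simp⟩
    · exact ⟨C, hC, fun _ _ => Iff.rfl⟩
  obtain ⟨f, hf, hfS⟩ := exists_arrangement_of_closed S hnot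
    (fun A hA B hB o hAo hBo => hmem _ fun hobs =>
      hS.1 (hasObstruction_of_insert_and hA hB hAo hBo hobs))
    (fun hstar => hS.1 hstar.hasObstruction) Finset.univ
  exact ⟨f, fun x y hxy => hf (by simp) (by simp) hxy, fun C hC => hfS C (hRS hC)⟩

end

/-! ### Arrangements and the circular-ones property -/

/-- The positions of the ones of a row in a circular arrangement of `N` columns do not alternate
with the positions of the zeros. -/
theorem not_alternating_of_consecutive {N : ℕ} {g : Fin N → Bool} {s n : ℕ}
    (h : ∀ j : Fin N, g j = true ↔ ∃ t < n, (j : ℕ) = (s + t) % N) {x y z t : Fin N}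
    (hxy : x < y) (hyz : y < z) (hzt : z < t) (e1 : g x = g z) (e2 : g y = g t)
    (e3 : g x ≠ g y) : False := by
  have hN : 0 < N := x.pos
  -- the same run of ones, with its start and its length reduced to `s % N` and `min n N`
  have key : ∀ j : Fin N, g j = true ↔
      (s % N ≤ j ∧ (j : ℕ) < s % N + min n N) ∨ (j : ℕ) + N < s % N + min n N := by
    intro j
    have hs := Nat.mod_lt s hN
    rw [h j]
    constructor
    · rintro ⟨t, ht, hj⟩
      have ht' := Nat.mod_lt t hN
      have ht2 := Nat.mod_le t N
      rw [Nat.add_mod] at hj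
      by_cases hlt : s % N + t % N < N
      · rw [Nat.mod_eq_of_lt hlt] at hj
        left
        omega
      · rw [Nat.mod_eq_sub_mod (by omega), Nat.mod_eq_of_lt (by omega)] at hj
        right
        omega
    · have hj := j.2
      rintro (⟨h1, h2⟩ | h1)
      · refine ⟨j - s % N, by omega, ?_⟩
        rw [Nat.add_mod, Nat.mod_eq_of_lt (by omega : (j : ℕ) - s % N < N),
          show s % N + (j - s % N) = j by omega, Nat.mod_eq_of_lt hj]
      · refine ⟨j + N - s % N, by omega, ?_⟩
        rw [Nat.add_mod, Nat.mod_eq_of_lt (by omega : (j : ℕ) + N - s % N < N),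
          show s % N + (j + N - s % N) = j + N by omega, Nat.add_mod_right, Nat.mod_eq_of_lt hj]
  have kx := key x
  have ky := key y
  have kz := key z
  have kt := key t
  have h1 := Fin.lt_def.1 hxy
  have h2 := Fin.lt_def.1 hyz
  have h3 := Fin.lt_def.1 hzt
  have hx := t.2
  rw [← e1] at kz
  rw [← e2] at kt
  cases hgx : g x <;> cases hgy : g y <;> simp only [hgx, hgy, true_iff, false_iff,
    Bool.false_eq_true, ne_eq, not_true_eq_false] at kx ky kz kt e3 <;> omega

/-- A row whose ones and zeros do not alternate has its ones in circularly consecutive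
positions. -/
theorem exists_consecutive_of_not_alternating {N : ℕ} {g : Fin N → Bool}
    (h : ∀ x y z t : Fin N, x < y → y < z → z < t → ¬ (g x = g z ∧ g y = g t ∧ g x ≠ g y)) :
    ∃ s n : ℕ, ∀ j : Fin N, g j = true ↔ ∃ t < n, (j : ℕ) = (s + t) % N := by
  by_cases hT : ∃ j, g j = true
  swap
  · push Not at hT
    exact ⟨0, 0, fun j => by simp [hT j]⟩
  by_cases hF : ∃ j, g j = false
  swap
  · push Not at hF
    refine ⟨0, N, fun j => ?_⟩
    have := hF j
    simp only [ne_eq, Bool.not_eq_false] at this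
    simp only [this, true_iff]
    exact ⟨j, j.2, by rw [Nat.zero_add, Nat.mod_eq_of_lt j.2]⟩
  have hN : 0 < N := hT.choose.pos
  -- the first and the last position of the value not taken at position `0`
  obtain ⟨v, hv⟩ : ∃ v, g ⟨0, hN⟩ = !v := ⟨!g ⟨0, hN⟩, by simp⟩
  have hne : (Finset.univ.filter (fun j => g j = v)).Nonempty := by
    cases v
    · exact hF.imp fun j hj => by simpa using hj
    · exact hT.imp fun j hj => by simpa using hj
  obtain ⟨a, ha, hamin⟩ := Finset.exists_min_image _ (fun j : Fin N => j) hne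
  obtain ⟨b, hb, hbmax⟩ := Finset.exists_max_image _ (fun j : Fin N => j) hne
  simp only [Finset.mem_filter, Finset.mem_univ, true_and] at ha hb hamin hbmax
  have ha0 : (0 : ℕ) < a := by
    rcases Nat.eq_zero_or_pos (a : ℕ) with h0 | h0
    · have : a = ⟨0, hN⟩ := Fin.ext h0
      rw [this, hv] at ha
      simp at ha
    · exact h0
  have hiff : ∀ j : Fin N, g j = v ↔ (a : ℕ) ≤ j ∧ (j : ℕ) ≤ b := by
    intro j
    refine ⟨fun hj => ⟨hamin j hj, hbmax j hj⟩, fun ⟨h1, h2⟩ => ?_⟩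
    by_contra hj
    have haj : (a : ℕ) ≠ j := fun e => hj (by rw [← Fin.ext e]; exact ha)
    have hjb : (j : ℕ) ≠ b := fun e => hj (by rw [Fin.ext e]; exact hb)
    refine h ⟨0, hN⟩ a j b (Fin.lt_def.2 ha0) (Fin.lt_def.2 (by omega)) (Fin.lt_def.2 (by omega))
      ⟨?_, by rw [ha, hb], by rw [hv, ha]; simp⟩
    rw [hv]
    revert hj
    cases g j <;> cases v <;> simp
  have hab : (a : ℕ) ≤ b := ((hiff a).1 ha).2
  have hbN := b.2
  cases v
  · refine ⟨b + 1, N - (b - a + 1), fun j => ?_⟩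
    have hj := j.2
    have hgj : g j = true ↔ ¬ ((a : ℕ) ≤ j ∧ (j : ℕ) ≤ b) := by rw [← hiff]; simp
    rw [hgj]
    constructor
    · intro h1
      by_cases h2 : (j : ℕ) < a
      · refine ⟨N + j - (b + 1), by omega, ?_⟩
        rw [show b + 1 + (N + j - (b + 1)) = N + (j : ℕ) by omega, Nat.add_mod_left,
          Nat.mod_eq_of_lt hj]
      · refine ⟨j - (b + 1), by omega, ?_⟩
        rw [show b + 1 + (j - (b + 1)) = (j : ℕ) by omega, Nat.mod_eq_of_lt hj]
    · rintro ⟨t, ht, hjt⟩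
      by_cases hlt : b + 1 + t < N
      · rw [Nat.mod_eq_of_lt hlt] at hjt
        omega
      · rw [Nat.mod_eq_sub_mod (by omega), Nat.mod_eq_of_lt (by omega)] at hjt
        omega
  · refine ⟨a, b - a + 1, fun j => ?_⟩
    have hj := j.2
    rw [hiff]
    constructor
    · intro h1
      exact ⟨j - a, by omega, by rw [show a + (j - a) = (j : ℕ) by omega, Nat.mod_eq_of_lt hj]⟩
    · rintro ⟨t, ht, hjt⟩
      rw [Nat.mod_eq_of_lt (by omega)] at hjt
      omega

theorem hasCircularOnes_iff (M : BinMatrix) : M.HasCircularOnes ↔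
    ∃ f : Fin M.numCols → ℤ, Function.Injective f ∧
      ∀ i, IsArcOn f Finset.univ (M.mat i) := by
  constructor
  · rintro ⟨σ, h⟩
    refine ⟨fun j => ((σ.symm j : ℕ) : ℤ), ?_, ?_⟩
    · intro x y hxy
      simpa [Fin.val_inj] using hxy
    · intro i x _ y _ z _ t _ hxy hyz hzt ⟨e1, e2, e3⟩
      obtain ⟨s, n, hi⟩ := h i
      refine not_alternating_of_consecutive (x := σ.symm x) (y := σ.symm y) (z := σ.symm z)
        (t := σ.symm t) (g := fun j => M.mat i (σ j)) hi ?_ ?_ ?_ ?_ ?_ ?_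
      · simpa using hxy
      · simpa using hyz
      · simpa using hzt
      · simpa using e1
      · simpa using e2
      · simpa using e3
  · rintro ⟨f, hf, h⟩
    have hmono : StrictMono (f ∘ Tuple.sort f) :=
      (Tuple.monotone_sort f).strictMono_of_injective (hf.comp (Tuple.sort f).injective)
    exact ⟨Tuple.sort f, fun i => exists_consecutive_of_not_alternating
      fun x y z t hxy hyz hzt => h i _ (Finset.mem_univ _) _ (Finset.mem_univ _) _
        (Finset.mem_univ _) _ (Finset.mem_univ _) (hmono hxy) (hmono hyz) (hmono hzt)⟩

/-! ### Obstructions exclude a circular arrangement -/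

section
variable {X : Type*} [Fintype X] {R : Set (X → Bool)}

/-- If `w` comes last, the points of an arc on the other side than `w` form an interval. -/
theorem IsArcOn.not_between {g : X → ℤ} {C : X → Bool} {w : X} (hg : ∀ x, x ≠ w → g x < g w)
    (h : IsArcOn g Finset.univ C) {x y z : X} (hx : C x ≠ C w) (hz : C z ≠ C w) (hy : C y = C w) :
    ¬ (g x < g y ∧ g y < g z) := by
  rintro ⟨h1, h2⟩
  have hzw : z ≠ w := by rintro rfl; exact hz rfl
  refine h x (Finset.mem_univ _) y (Finset.mem_univ _) z (Finset.mem_univ _) w (Finset.mem_univ _)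
    h1 h2 (hg z hzw) ⟨?_, hy, by rw [hy]; exact hx⟩
  revert hx hz
  cases C x <;> cases C z <;> cases C w <;> simp

theorem not_hasCycle_of_arrangement {f : X → ℤ} (hf : Function.Injective f)
    (hR : ∀ C ∈ R, IsArcOn f Finset.univ C) : ¬ HasCycle R := by
  rintro ⟨m, p, w, r, E, hm, hr, hE, h⟩
  obtain ⟨g, hg, hgw, hrot⟩ := exists_rotation f Finset.univ (hf.injOn) (Finset.mem_univ w)
  replace hg : Function.Injective g := fun x y hxy => hg (by simp) (by simp) hxy
  replace hgw : ∀ x, x ≠ w → g x < g w := fun x hx => hgw x (Finset.mem_univ _) hx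
  have hRg : ∀ C ∈ R, IsArcOn g Finset.univ C := fun C hC => hrot C (hR C hC)
  -- the leftmost point of the cycle cannot have two neighbours
  have key : ∀ a n₁ n₂ : X, ∀ C₁ ∈ R, ∀ C₂ ∈ R, g a ≤ g n₁ → g a ≤ g n₂ → C₁ a ≠ C₁ w →
      C₁ n₁ ≠ C₁ w → C₁ n₂ = C₁ w → C₂ a ≠ C₂ w → C₂ n₂ ≠ C₂ w → C₂ n₁ = C₂ w → False := by
    intro a n₁ n₂ C₁ hC₁ C₂ hC₂ h1 h2 h3 h4 h5 h6 h7 h8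
    have e1 : g a ≠ g n₁ := fun e => h6 (by rw [hg e, h8])
    have e2 : g a ≠ g n₂ := fun e => h3 (by rw [hg e, h5])
    have e3 : g n₁ ≠ g n₂ := fun e => h4 (by rw [hg e, h5])
    have b1 := (hRg C₁ hC₁).not_between hgw h3 h4 h5
    have b2 := (hRg C₂ hC₂).not_between hgw h6 h7 h8
    omega
  obtain ⟨a, ha, hmin⟩ := Finset.exists_min_image (Finset.range (m + 1)) (fun j => g (p j))
    ⟨0, by simp⟩
  simp only [Finset.mem_range] at ha hmin
  have hrow : ∀ i < m, ∀ j ≤ m, j ≠ i → j ≠ i + 1 → r i (p j) = r i w := by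
    intro i hi j hj h1 h2
    by_contra hc
    exact ((h.row i hi j hj).1 hc).elim h1 h2
  have hclosing : ∀ j ≤ m, j ≠ 0 → j ≠ m → E (p j) = E w := by
    intro j hj h1 h2
    by_contra hc
    exact ((h.closing j hj).1 hc).elim h1 h2
  have hrow' : ∀ i < m, r i (p i) ≠ r i w ∧ r i (p (i + 1)) ≠ r i w := fun i hi =>
    ⟨(h.row i hi i hi.le).2 (Or.inl rfl), (h.row i hi (i + 1) hi).2 (Or.inr rfl)⟩
  have hclosing' : E (p 0) ≠ E w ∧ E (p m) ≠ E w :=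
    ⟨(h.closing 0 (by omega)).2 (Or.inl rfl), (h.closing m le_rfl).2 (Or.inr rfl)⟩
  rcases Nat.eq_zero_or_pos a with rfl | ha0
  · exact key (p 0) (p 1) (p m) (r 0) (hr 0 (by omega)) E hE (hmin 1 (by omega))
      (hmin m (by omega)) (hrow' 0 (by omega)).1 (hrow' 0 (by omega)).2
      (hrow 0 (by omega) m le_rfl (by omega) (by omega)) hclosing'.1 hclosing'.2
      (hclosing 1 (by omega) (by omega) (by omega))
  obtain ⟨b, rfl⟩ : ∃ b, a = b + 1 := ⟨a - 1, by omega⟩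
  by_cases hbm : b + 1 = m
  · subst hbm
    exact key (p (b + 1)) (p b) (p 0) (r b) (hr b (by omega)) E hE (hmin b (by omega))
      (hmin 0 (by omega)) (hrow' b (by omega)).2 (hrow' b (by omega)).1
      (hrow b (by omega) 0 (by omega) (by omega) (by omega)) hclosing'.2 hclosing'.1
      (hclosing b (by omega) (by omega) (by omega))
  · exact key (p (b + 1)) (p b) (p (b + 2)) (r b) (hr b (by omega)) (r (b + 1)) (hr _ (by omega))
      (hmin b (by omega)) (hmin (b + 2) (by omega)) (hrow' b (by omega)).2 (hrow' b (by omega)).1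
      (hrow b (by omega) (b + 2) (by omega) (by omega) (by omega)) (hrow' (b + 1) (by omega)).1
      (hrow' (b + 1) (by omega)).2
      (hrow (b + 1) (by omega) b (by omega) (by omega) (by omega))

theorem not_hasTransversal_of_arrangement {f : X → ℤ} (hf : Function.Injective f)
    (hR : ∀ C ∈ R, IsArcOn f Finset.univ C) : ¬ HasTransversal R := by
  rintro ⟨a₁, w, b₁, b₂, c₁, c₂, A, B, C, T, hA, hB, hC, hT, h⟩
  obtain ⟨g, hg, hgw, hrot⟩ := exists_rotation f Finset.univ (hf.injOn) (Finset.mem_univ w)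
  replace hg : Function.Injective g := fun x y hxy => hg (by simp) (by simp) hxy
  replace hgw : ∀ x, x ≠ w → g x < g w := fun x hx => hgw x (Finset.mem_univ _) hx
  have hne : ∀ (D : X → Bool) {x y : X}, D x ≠ D y → g x ≠ g y := fun D x y hD e =>
    hD (by rw [hg e])
  obtain ⟨⟨x1, x2, x3, x4, x5⟩, ⟨y1, y2, y3, y4, y5⟩, ⟨z1, z2, z3, z4, z5⟩,
    t1, t2, t3, t4, t5⟩ := h
  have nA := fun {x y z} => (hrot A (hR A hA)).not_between hgw (x := x) (y := y) (z := z)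
  have nB := fun {x y z} => (hrot B (hR B hB)).not_between hgw (x := x) (y := y) (z := z)
  have nC := fun {x y z} => (hrot C (hR C hC)).not_between hgw (x := x) (y := y) (z := z)
  have nT := fun {x y z} => (hrot T (hR T hT)).not_between hgw (x := x) (y := y) (z := z)
  -- sides of the four rows relative to `w`
  have Ab₁ : A b₁ ≠ A w := by rw [← x1]; exact x5.symm
  have Ab₂ : A b₂ ≠ A w := by rw [← x2]; exact Ab₁
  have Ac₁ : A c₁ ≠ A w := by rw [x3]; exact Ab₁
  have Ac₂ : A c₂ ≠ A w := by rw [x4]; exact Ab₁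
  have Bc : B c₁ = B w := by rw [y4]
  have Bb₁ : B b₁ ≠ B w := by rw [← Bc]; exact y5
  have Bb₂ : B b₂ ≠ B w := by rw [← y1]; exact Bb₁
  have Ba : B a₁ = B w := by rw [y3, Bc]
  have Bc₂ : B c₂ = B w := by rw [← y2, Bc]
  have Ca : C a₁ = C w := z2
  have Cc₁ : C c₁ ≠ C w := by rw [← Ca]; exact z5
  have Cc₂ : C c₂ ≠ C w := by rw [← z1]; exact Cc₁
  have Cb₁ : C b₁ = C w := by rw [z3, Ca]
  have Tb₁ : T b₁ ≠ T w := by rw [t1]; exact t5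
  have Tc₁ : T c₁ ≠ T w := by rw [t2]; exact t5
  have hb₁ : g a₁ ≠ g b₁ := hne A x5
  have hb₂ : g a₁ ≠ g b₂ := hne A (by rw [← x2]; exact x5)
  have hc₁ : g a₁ ≠ g c₁ := hne A (by rw [x3]; exact x5)
  have hc₂ : g a₁ ≠ g c₂ := hne A (by rw [x4]; exact x5)
  have hbc : g b₁ ≠ g c₁ := hne B (by rw [Bc]; exact Bb₁)
  have hbb : g b₁ ≠ g b₂ := hne T (by rw [t3]; exact Tb₁)
  have hcc : g c₁ ≠ g c₂ := hne T (by rw [t4]; exact Tc₁)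
  have hcb : g c₁ ≠ g b₂ := hne T (by rw [t3]; exact Tc₁)
  have hbc' : g b₁ ≠ g c₂ := hne T (by rw [t4]; exact Tb₁)
  have B1 := nB Bb₁ Bb₂ Bc
  have B2 := nB Bb₂ Bb₁ Bc
  have C1 := nC Cc₁ Cc₂ Cb₁
  have C2 := nC Cc₂ Cc₁ Cb₁
  -- `a₁` is next to `w` among the six columns, hence first or last; the two cases are symmetric
  rcases lt_or_gt_of_ne hb₁ with hlt | hlt
  · have A1 := nA Ab₂ Ab₁ x1
    have A2 := nA Ac₁ Ab₁ x1
    have A3 := nA Ac₂ Ab₁ x1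
    have T1 := nT t5 Tb₁ t3
    have T2 := nT t5 Tc₁ t3
    have T3 := nT t5 Tb₁ t4
    have T4 := nT t5 Tc₁ t4
    omega
  · have A1 := nA Ab₁ Ab₂ x1
    have A2 := nA Ab₁ Ac₁ x1
    have A3 := nA Ab₁ Ac₂ x1
    have T1 := nT Tb₁ t5 t3
    have T2 := nT Tc₁ t5 t3
    have T3 := nT Tb₁ t5 t4
    have T4 := nT Tc₁ t5 t4
    omega

theorem not_hasObstruction_of_arrangement {f : X → ℤ} (hf : Function.Injective f)
    (hR : ∀ C ∈ R, IsArcOn f Finset.univ C) : ¬ HasObstruction R := fun h =>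
  h.elim (not_hasCycle_of_arrangement hf hR) (not_hasTransversal_of_arrangement hf hR)

end

/-- A matrix has the circular-ones property if and only if its rows contain no obstruction. -/
theorem hasCircularOnes_iff_not_hasObstruction (M : BinMatrix) :
    M.HasCircularOnes ↔ ¬ HasObstruction (Set.range M.mat) := by
  rw [hasCircularOnes_iff]
  constructor
  · rintro ⟨f, hf, h⟩
    exact not_hasObstruction_of_arrangement hf (Set.forall_mem_range.2 h)
  · intro h
    obtain ⟨f, hf, h⟩ := exists_arrangement_of_not_hasObstruction h
    exact ⟨f, hf, Set.forall_mem_range.1 h⟩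

/-! ### Configurations -/

theorem exists_orderEmbedding_comp_perm {n m : ℕ} (ρ : Fin n → Fin m)
    (hρ : Function.Injective ρ) :
    ∃ (f : Fin n ↪o Fin m) (e : Equiv.Perm (Fin n)), ∀ i, f (e i) = ρ i := by
  have hmono : StrictMono (ρ ∘ Tuple.sort ρ) :=
    (Tuple.monotone_sort ρ).strictMono_of_injective (hρ.comp (Tuple.sort ρ).injective)
  exact ⟨OrderEmbedding.ofStrictMono _ hmono, (Tuple.sort ρ).symm, fun i => by simp⟩

theorem containsConfiguration_iff (M F : BinMatrix) : M.ContainsConfiguration F ↔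
    ∃ (ρ : Fin F.numRows → Fin M.numRows) (τ : Fin F.numCols → Fin M.numCols),
      Function.Injective ρ ∧ Function.Injective τ ∧ ∀ i j, F.mat i j = M.mat (ρ i) (τ j) := by
  constructor
  · rintro ⟨N, ⟨f, g, hN⟩, ρ, τ, hF⟩
    refine ⟨f ∘ ρ, g ∘ τ, f.injective.comp ρ.injective, g.injective.comp τ.injective, ?_⟩
    intro i j
    rw [hF, hN]
    rfl
  · rintro ⟨ρ, τ, hρ, hτ, h⟩
    obtain ⟨f, e, he⟩ := exists_orderEmbedding_comp_perm ρ hρ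
    obtain ⟨g, d, hd⟩ := exists_orderEmbedding_comp_perm τ hτ
    refine ⟨⟨F.numRows, F.numCols, M.mat.submatrix f g⟩, ⟨f, g, rfl⟩, e, d, ?_⟩
    ext i j
    simp [h, he, hd]

theorem BinMatrix.SameConfiguration.symm {M N : BinMatrix} (h : M.SameConfiguration N) :
    N.SameConfiguration M := by
  obtain ⟨ρ, τ, h⟩ := h
  exact ⟨ρ.symm, τ.symm, by rw [h]; ext i j; simp⟩

theorem BinMatrix.SameConfiguration.trans {M N K : BinMatrix} (h : M.SameConfiguration N)
    (h' : N.SameConfiguration K) : M.SameConfiguration K := by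
  obtain ⟨ρ, τ, h⟩ := h
  obtain ⟨ρ', τ', h'⟩ := h'
  exact ⟨ρ'.trans ρ, τ'.trans τ, by rw [h', h]; rfl⟩

theorem BinMatrix.ContainsConfiguration.trans_same {M F G : BinMatrix}
    (h : M.ContainsConfiguration F) (h' : F.SameConfiguration G) : M.ContainsConfiguration G := by
  obtain ⟨N, hN, hF⟩ := h
  exact ⟨N, hN, hF.trans h'⟩

theorem sameConfiguration_of_injective {r c : ℕ} {A B : Matrix (Fin r) (Fin c) Bool}
    (ρ : Fin r → Fin r) (τ : Fin c → Fin c) (hρ : Function.Injective ρ)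
    (hτ : Function.Injective τ) (h : B = A.submatrix ρ τ) :
    BinMatrix.SameConfiguration ⟨r, c, A⟩ ⟨r, c, B⟩ :=
  ⟨Equiv.ofBijective ρ (Finite.injective_iff_bijective.1 hρ),
    Equiv.ofBijective τ (Finite.injective_iff_bijective.1 hτ), h⟩

/-- The circular-ones property is inherited by configurations. -/
theorem BinMatrix.HasCircularOnes.of_contains {M F : BinMatrix} (hM : M.HasCircularOnes)
    (h : M.ContainsConfiguration F) : F.HasCircularOnes := by
  obtain ⟨ρ, τ, -, -, h⟩ := (containsConfiguration_iff M F).1 h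
  rw [hasCircularOnes_iff_not_hasObstruction] at hM ⊢
  refine fun hF => hM (hF.of_map τ ?_)
  rintro _ ⟨i, rfl⟩
  exact ⟨_, ⟨ρ i, rfl⟩, fun x y => by rw [h, h]⟩

/-- To contain a configuration without repeated rows or columns, it suffices to find its entries. -/
theorem containsConfiguration_of_entries {M : BinMatrix} {r c : ℕ}
    {A : Matrix (Fin r) (Fin c) Bool} (hrow : ∀ i i', (∀ j, A i j = A i' j) → i = i')
    (hcol : ∀ x y, (∀ i, A i x = A i y) → x = y) (ρ : Fin r → Fin M.numRows)
    (τ : Fin c → Fin M.numCols) (h : ∀ i j, A i j = M.mat (ρ i) (τ j)) :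
    M.ContainsConfiguration ⟨r, c, A⟩ := by
  refine (containsConfiguration_iff _ _).2
    ⟨ρ, τ, fun i i' e => hrow i i' ?_, fun x y e => hcol x y ?_, h⟩
  · intro j
    rw [h, h, e]
  · intro i
    rw [h, h, e]

/-! ### The matrices of the cycles -/

/-- The matrix `a ⊙ M_I(k)*`. Its last column is `a`, and row `i` differs from its last entry
exactly in the columns `i` and `i + 1` modulo `k`. -/
def cycleMatrix (k : ℕ) (a : Fin k → Bool) : Matrix (Fin k) (Fin (k + 1)) Bool :=
  complementRows a (starMatrix (tuckerI k))

theorem cycleMatrix_apply {k : ℕ} (a : Fin k → Bool) (i : Fin k) (j : Fin (k + 1)) :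
    cycleMatrix k a i j =
      xor (a i) (decide ((j : ℕ) = i ∨ (j : ℕ) = if (i : ℕ) + 1 = k then 0 else (i : ℕ) + 1)) := by
  have hi := i.2
  have hmod : ((i : ℕ) + 1) % k = if (i : ℕ) + 1 = k then 0 else (i : ℕ) + 1 := by
    split_ifs with h
    · rw [h, Nat.mod_self]
    · exact Nat.mod_eq_of_lt (by omega)
  simp only [cycleMatrix, complementRows, starMatrix, tuckerI, Matrix.of_apply, hmod]
  by_cases hj : (j : ℕ) < k
  · cases a i <;> simp [hj]
  · have h1 : ¬ ((j : ℕ) = i ∨ (j : ℕ) = if (i : ℕ) + 1 = k then 0 else (i : ℕ) + 1) := by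
      split_ifs <;> omega
    cases a i <;> simp [hj, h1]

theorem cycleMatrix_eq_iff {k : ℕ} (a : Fin k → Bool) (i : Fin k) (j : Fin (k + 1)) :
    cycleMatrix k a i j = !a i ↔
      (j : ℕ) = i ∨ (j : ℕ) = if (i : ℕ) + 1 = k then 0 else (i : ℕ) + 1 := by
  rw [cycleMatrix_apply]
  cases a i <;> simp [or_iff_not_imp_left]

theorem cycleMatrix_last {k : ℕ} (a : Fin k → Bool) (i : Fin k) :
    cycleMatrix k a i (Fin.last k) = a i := by
  have hi := i.2
  have h : ¬ (cycleMatrix k a i (Fin.last k) = !a i) := by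
    rw [cycleMatrix_eq_iff, Fin.val_last]
    split_ifs <;> omega
  simpa using h

theorem cycleMatrix_row_injective {k : ℕ} (hk : 3 ≤ k) (a : Fin k → Bool) :
    Function.Injective (cycleMatrix k a) := by
  intro i i' h
  have ha : a i = a i' := by rw [← cycleMatrix_last a i, h, cycleMatrix_last]
  have hi := i.2
  have hi' := i'.2
  have key : ∀ j : Fin (k + 1),
      ((j : ℕ) = i ∨ (j : ℕ) = if (i : ℕ) + 1 = k then 0 else (i : ℕ) + 1) ↔
      ((j : ℕ) = i' ∨ (j : ℕ) = if (i' : ℕ) + 1 = k then 0 else (i' : ℕ) + 1) := by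
    intro j
    rw [← cycleMatrix_eq_iff a, ← cycleMatrix_eq_iff a, h, ha]
  have h1 := key ⟨i, by omega⟩
  have h2 := key ⟨i', by omega⟩
  ext
  dsimp only at h1 h2
  split_ifs at h1 h2 <;> omega

theorem cycleMatrix_col_injective {k : ℕ} (hk : 3 ≤ k) (a : Fin k → Bool) (x y : Fin (k + 1))
    (h : ∀ i, cycleMatrix k a i x = cycleMatrix k a i y) : x = y := by
  have hx := x.2
  have hy := y.2
  have key : ∀ i : Fin k, ((x : ℕ) = i ∨ (x : ℕ) = if (i : ℕ) + 1 = k then 0 else (i : ℕ) + 1) ↔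
      ((y : ℕ) = i ∨ (y : ℕ) = if (i : ℕ) + 1 = k then 0 else (i : ℕ) + 1) := by
    intro i
    rw [← cycleMatrix_eq_iff a, ← cycleMatrix_eq_iff a, h]
  -- the rows having a one of the cycle in column `x`, or in column `y`
  have hrows : ∀ x y : Fin (k + 1), (∀ i : Fin k,
      ((x : ℕ) = i ∨ (x : ℕ) = if (i : ℕ) + 1 = k then 0 else (i : ℕ) + 1) ↔
      ((y : ℕ) = i ∨ (y : ℕ) = if (i : ℕ) + 1 = k then 0 else (i : ℕ) + 1)) → (x : ℕ) < k →
      (x : ℕ) = y := by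
    intro x y key hx
    have h1 := key ⟨x, hx⟩
    by_cases h0 : (x : ℕ) = 0
    · have h2 := key ⟨k - 1, by omega⟩
      dsimp only at h1 h2
      split_ifs at h1 h2 <;> omega
    · have h2 := key ⟨x - 1, by omega⟩
      dsimp only at h1 h2
      split_ifs at h1 h2 <;> omega
  ext
  by_cases h1 : (x : ℕ) < k
  · exact hrows x y key h1
  by_cases h2 : (y : ℕ) < k
  · exact (hrows y x (fun i => (key i).symm) h2).symm
  omega

theorem hasObstruction_cycleMatrix {k : ℕ} (hk : 3 ≤ k) (a : Fin k → Bool) :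
    HasObstruction (Set.range (cycleMatrix k a)) := by
  obtain ⟨m, rfl⟩ : ∃ m, k = m + 1 := ⟨k - 1, by omega⟩
  have hne : ∀ (i : Fin (m + 1)) (j : Fin (m + 2)),
      (cycleMatrix (m + 1) a i j ≠ cycleMatrix (m + 1) a i (Fin.last (m + 1)) ↔
        (j : ℕ) = i ∨ (j : ℕ) = if (i : ℕ) + 1 = m + 1 then 0 else (i : ℕ) + 1) := by
    intro i j
    rw [← cycleMatrix_eq_iff a, cycleMatrix_last]
    cases cycleMatrix (m + 1) a i j <;> cases a i <;> simp
  refine Or.inl ⟨m, fun j => ⟨min j (m + 1), by omega⟩, Fin.last _,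
    fun i => cycleMatrix (m + 1) a ⟨min i m, by omega⟩, cycleMatrix (m + 1) a (Fin.last m),
    by omega, fun i _ => ⟨_, rfl⟩, ⟨_, rfl⟩, ?_, ?_⟩
  · intro i hi j hj
    rw [hne]
    dsimp only
    simp only [min_eq_left hi.le, min_eq_left (show j ≤ m + 1 by omega)]
    rw [if_neg (by omega)]
  · intro j hj
    rw [hne]
    dsimp only [Fin.val_last]
    rw [min_eq_left (by omega), if_pos rfl]
    tauto

/-- The row `a` of complementations is read off from the column `w` of the cycle. -/
theorem exists_cycleMatrix_of_hasCycle {M : BinMatrix} (h : HasCycle (Set.range M.mat)) :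
    ∃ k, 3 ≤ k ∧ ∃ a : Fin k → Bool, M.ContainsConfiguration ⟨k, k + 1, cycleMatrix k a⟩ := by
  obtain ⟨m, p, w, r, E, hm, hr, ⟨e, rfl⟩, h⟩ := h
  have : Nonempty (Fin M.numRows) := ⟨e⟩
  choose! s hs using hr
  let ρ : Fin (m + 1) → Fin M.numRows := fun i => if (i : ℕ) < m then s i else e
  let τ : Fin (m + 1 + 1) → Fin M.numCols := fun j => if (j : ℕ) ≤ m then p j else w
  refine ⟨m + 1, by omega, fun i => M.mat (ρ i) w, containsConfiguration_of_entries
    (fun _ _ e => cycleMatrix_row_injective (by omega) _ (funext e))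
    (cycleMatrix_col_injective (by omega) _) ρ τ ?_⟩
  intro i j
  have key : M.mat (ρ i) (τ j) = (!M.mat (ρ i) w) ↔
      (j : ℕ) = i ∨ (j : ℕ) = if (i : ℕ) + 1 = m + 1 then 0 else (i : ℕ) + 1 := by
    have hi := i.2
    have hj := j.2
    by_cases h1 : (j : ℕ) ≤ m
    · by_cases h2 : (i : ℕ) < m
      · simp only [τ, ρ, h1, h2, if_true]
        rw [hs i h2, Bool.eq_not, h.row i h2 j h1, if_neg (by omega)]
      · simp only [τ, ρ, h1, h2, if_true, if_false]
        rw [Bool.eq_not, h.closing j h1, if_pos (by omega)]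
        omega
    · simp only [τ, h1, if_false]
      constructor
      · intro hc
        simp at hc
      · split_ifs <;> omega
  have h2 := cycleMatrix_eq_iff (fun i => M.mat (ρ i) w) i j
  rw [← key] at h2
  revert h2
  cases M.mat (ρ i) (τ j) <;> cases M.mat (ρ i) w <;>
    cases cycleMatrix (m + 1) (fun i => M.mat (ρ i) w) i j <;> simp

/-! ### Bracelets -/

theorem val_finRotate {k : ℕ} (i : Fin k) :
    (finRotate k i : ℕ) = if (i : ℕ) + 1 = k then 0 else (i : ℕ) + 1 := by
  obtain ⟨n, rfl⟩ : ∃ n, k = n + 1 := ⟨k - 1, by have := i.2; omega⟩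
  rw [coe_finRotate]
  simp [Fin.ext_iff]

/-- The two copies of a cycle are matched by rotating its rows and its first `k` columns. -/
theorem cycleMatrix_same_shift {k : ℕ} (a : Fin k → Bool) :
    BinMatrix.SameConfiguration ⟨k, k + 1, cycleMatrix k a⟩
      ⟨k, k + 1, cycleMatrix k (shiftSeq a)⟩ := by
  refine sameConfiguration_of_injective (finRotate k) (fun j => if h : (j : ℕ) < k then
    (finRotate k ⟨j, h⟩).castSucc else j) (finRotate k).injective ?_ ?_
  · intro x y hxy
    have h1 := congrArg Fin.val hxy
    have hx := x.2
    have hy := y.2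
    ext
    dsimp only at h1
    split_ifs at h1 with c1 c2 c2
    · simp only [Fin.val_castSucc, val_finRotate] at h1
      split_ifs at h1 <;> omega
    · simp only [Fin.val_castSucc, val_finRotate] at h1
      split_ifs at h1 <;> omega
    · simp only [Fin.val_castSucc, val_finRotate] at h1
      split_ifs at h1 <;> omega
    · exact h1
  · ext i j
    rw [Matrix.submatrix_apply]
    have hi := i.2
    have hj := j.2
    rw [cycleMatrix_apply, cycleMatrix_apply]
    congr 1
    rw [decide_eq_decide]
    simp only [val_finRotate]
    by_cases c : (j : ℕ) < k
    · simp only [c, dif_pos, Fin.val_castSucc, val_finRotate]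
      -- names for the successors modulo `k`, so that the goal becomes linear
      have key : ∀ x : ℕ, ∃ y, (if x + 1 = k then 0 else x + 1) = y ∧
          (x + 1 = k ∧ y = 0 ∨ x + 1 ≠ k ∧ y = x + 1) := fun x => by
        by_cases h : x + 1 = k <;> simp [h]
      obtain ⟨p, hp, hp'⟩ := key i
      obtain ⟨q, hq, hq'⟩ := key j
      obtain ⟨r, hr, hr'⟩ := key p
      rw [hp, hq, hr]
      omega
    · simp only [c, dif_neg, not_false_eq_true]
      split_ifs <;> omega

/-- Row `i`, which joins the columns `i` and `i + 1`, is matched with row `k - 1 - i`; so column `j`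
of the cycle has to be matched with column `k - j` modulo `k`. -/
theorem cycleMatrix_same_reverse {k : ℕ} (a : Fin k → Bool) :
    BinMatrix.SameConfiguration ⟨k, k + 1, cycleMatrix k a⟩
      ⟨k, k + 1, cycleMatrix k (reverseSeq a)⟩ := by
  refine sameConfiguration_of_injective Fin.rev (fun j => if (j : ℕ) = k ∨ (j : ℕ) = 0 then j else
    ⟨k - j, by omega⟩) Fin.rev_injective ?_ ?_
  · intro x y hxy
    have h1 := congrArg Fin.val hxy
    have hx := x.2
    have hy := y.2
    ext
    dsimp only at h1
    split_ifs at h1 <;> (try dsimp only at h1) <;> omega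
  · ext i j
    rw [Matrix.submatrix_apply]
    have hi := i.2
    have hj := j.2
    rw [cycleMatrix_apply, cycleMatrix_apply]
    congr 1
    rw [decide_eq_decide, Fin.val_rev]
    by_cases c : (j : ℕ) = k ∨ (j : ℕ) = 0
    · simp only [c, if_true]
      split_ifs <;> omega
    · simp only [c, if_false]
      split_ifs <;> omega

theorem cycleMatrix_same_of_shiftRevEquiv {k : ℕ} {a b : Fin k → Bool} (h : ShiftRevEquiv a b) :
    BinMatrix.SameConfiguration ⟨k, k + 1, cycleMatrix k a⟩ ⟨k, k + 1, cycleMatrix k b⟩ := by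
  induction h with
  | rel a b h =>
    rcases h with rfl | rfl
    · exact cycleMatrix_same_shift a
    · exact cycleMatrix_same_reverse a
  | refl a => exact ⟨Equiv.refl _, Equiv.refl _, rfl⟩
  | symm a b _ ih => exact ih.symm
  | trans a b c _ _ ih ih' => exact ih.trans ih'

theorem exists_bracelet {k : ℕ} (a : Fin k → Bool) : ∃ b, ShiftRevEquiv a b ∧ IsBracelet b := by
  obtain ⟨b, hb, hmin⟩ := Set.exists_min_image {b | ShiftRevEquiv a b} toLex (Set.toFinite _)
    ⟨a, Relation.EqvGen.refl a⟩
  exact ⟨b, hb, fun c hc => hmin c (Relation.EqvGen.trans _ _ _ hb hc)⟩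

theorem shiftRevEquiv_add {n : ℕ} (a : Fin (n + 1) → Bool) (s : Fin (n + 1)) :
    ShiftRevEquiv a (fun i => a (i + s)) := by
  induction s using Fin.induction with
  | zero =>
    simp only [add_zero]
    exact Relation.EqvGen.refl a
  | succ t ih =>
    refine Relation.EqvGen.trans _ _ _ ih (Relation.EqvGen.rel _ _ (Or.inl ?_))
    ext i
    simp only [shiftSeq, finRotate_apply, ← Fin.coeSucc_eq_succ]
    congr 1
    abel

/-- An injective self-map of a cycle of length at least three that preserves adjacency is a
rotation or a reflection. -/
theorem eq_rotation_or_reflection {n : ℕ} (hn : 2 ≤ n) {ρ : Fin (n + 1) → Fin (n + 1)}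
    (hρ : Function.Injective ρ) (h : ∀ i, ρ (i + 1) = ρ i + 1 ∨ ρ (i + 1) + 1 = ρ i) :
    (∀ i, ρ i = ρ 0 + i) ∨ ∀ i, ρ i = ρ 0 - i := by
  have h2 : ∀ t : Fin (n + 1), t + 1 + 1 ≠ t := by
    intro t ht
    have h3 : (1 + 1 : Fin (n + 1)) = 0 := by
      rw [add_assoc] at ht
      simpa using ht
    obtain ⟨m, rfl⟩ : ∃ m, n = m + 2 := ⟨n - 2, by omega⟩
    simp [Fin.ext_iff, Fin.val_add, Nat.mod_eq_of_lt (show 2 < m + 2 + 1 by omega)] at h3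
  rcases h 0 with h0 | h0
  · left
    have key : ∀ t, ρ (t + 1) = ρ t + 1 ∧ ρ t = ρ 0 + t := by
      intro t
      induction t using Fin.induction with
      | zero => simpa using h0
      | succ t ih =>
        rw [← Fin.coeSucc_eq_succ]
        refine ⟨?_, by rw [ih.1, ih.2, add_assoc]⟩
        rcases h (t.castSucc + 1) with h3 | h3
        · exact h3
        · rw [ih.1] at h3
          exact absurd (hρ (add_right_cancel h3)) (h2 _)
    exact fun i => (key i).2
  · right
    have key : ∀ t, ρ (t + 1) + 1 = ρ t ∧ ρ t = ρ 0 - t := by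
      intro t
      induction t using Fin.induction with
      | zero => simpa using h0
      | succ t ih =>
        rw [← Fin.coeSucc_eq_succ]
        refine ⟨?_, by rw [eq_sub_of_add_eq ih.1, ih.2, sub_sub]⟩
        rcases h (t.castSucc + 1) with h3 | h3
        · rw [ih.1] at h3
          exact absurd (hρ h3) (h2 _)
        · exact h3
    exact fun i => (key i).2

/-- Each row of a cycle has exactly two entries that differ from its entry in the last column. -/
theorem card_cycleMatrix_row {k : ℕ} (hk : 3 ≤ k) (a : Fin k → Bool) (i : Fin k) :
    (Finset.univ.filter (fun j => cycleMatrix k a i j = !a i)).card = 2 := by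
  have hi := i.2
  rw [Finset.card_eq_two]
  refine ⟨i.castSucc, (finRotate k i).castSucc, ?_, ?_⟩
  · rw [Ne, Fin.ext_iff, Fin.val_castSucc, Fin.val_castSucc, val_finRotate]
    split_ifs <;> omega
  · ext j
    simp only [Finset.mem_filter, Finset.mem_univ, true_and, Finset.mem_insert,
      Finset.mem_singleton, cycleMatrix_eq_iff, Fin.ext_iff, Fin.val_castSucc, val_finRotate]

/-- For `k ≥ 4` the configuration of `a ⊙ M_I(k)*` determines `a` up to shifts and reversals. For
`k = 3` this fails, because a row with two ones and two zeros has no majority value. -/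
theorem shiftRevEquiv_of_cycleMatrix_same {k : ℕ} (hk : 4 ≤ k) {a b : Fin k → Bool}
    (h : BinMatrix.SameConfiguration ⟨k, k + 1, cycleMatrix k a⟩ ⟨k, k + 1, cycleMatrix k b⟩) :
    ShiftRevEquiv a b := by
  obtain ⟨ρ, τ, h⟩ := h
  change Fin k ≃ Fin k at ρ
  change Fin (k + 1) ≃ Fin (k + 1) at τ
  replace h : ∀ i j, cycleMatrix k b i j = cycleMatrix k a (ρ i) (τ j) := fun i j => by
    have := congrFun (congrFun h i) j
    exact this
  -- a row with two exceptional entries out of `k + 1 ≥ 5` determines which entries these are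
  have hb : ∀ i, b i = a (ρ i) := by
    intro i
    by_contra hne
    have hne' : (!b i) = a (ρ i) := by
      revert hne
      cases b i <;> cases a (ρ i) <;> simp
    have h1 := card_cycleMatrix_row (by omega) b i
    have h2 : (Finset.univ.filter
        (fun j => ¬ cycleMatrix k a (ρ i) (τ j) = a (ρ i))).card = 2 := by
      rw [← card_cycleMatrix_row (by omega) a (ρ i)]
      refine Finset.card_bijective τ τ.bijective fun j => ?_
      simp [Bool.eq_not]
    simp only [h, hne'] at h1
    have h3 := Finset.card_filter_add_card_filter_not (s := (Finset.univ : Finset (Fin (k + 1))))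
      (fun j => cycleMatrix k a (ρ i) (τ j) = a (ρ i))
    rw [h1, h2, Finset.card_univ, Fintype.card_fin] at h3
    omega
  have hinc : ∀ (i : Fin k) (j : Fin (k + 1)),
      ((j : ℕ) = i ∨ (j : ℕ) = if (i : ℕ) + 1 = k then 0 else (i : ℕ) + 1) →
      (((τ j : Fin (k + 1)) : ℕ) = (ρ i : Fin k) ∨
        ((τ j : Fin (k + 1)) : ℕ) =
          if ((ρ i : Fin k) : ℕ) + 1 = k then 0 else ((ρ i : Fin k) : ℕ) + 1) := by
    intro i j hij
    rw [← cycleMatrix_eq_iff b, h, hb] at hij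
    rwa [← cycleMatrix_eq_iff a]
  obtain ⟨n, rfl⟩ : ∃ n, k = n + 1 := ⟨k - 1, by omega⟩
  -- consecutive rows share a column
  have hadj : ∀ i, ρ (i + 1) = ρ i + 1 ∨ ρ (i + 1) + 1 = ρ i := by
    intro i
    have hi := i.2
    have hr1 := (ρ i).2
    have hr2 := (ρ (i + 1)).2
    have hne : ρ i ≠ ρ (i + 1) := by
      intro he
      have := congrArg Fin.val (ρ.injective he)
      rw [← finRotate_apply i, val_finRotate] at this
      split_ifs at this <;> omega
    have h1 := hinc i (finRotate _ i).castSucc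
      (Or.inr (by rw [Fin.val_castSucc, val_finRotate]))
    have h2 := hinc (i + 1) (finRotate _ i).castSucc
      (Or.inl (by rw [Fin.val_castSucc, finRotate_apply]))
    rw [← finRotate_apply (ρ i), ← finRotate_apply (ρ (i + 1)), Fin.ext_iff, Fin.ext_iff,
      val_finRotate, val_finRotate]
    rw [Ne, Fin.ext_iff] at hne
    split_ifs at h1 h2 ⊢ <;> omega
  rcases eq_rotation_or_reflection (by omega) ρ.injective hadj with hrot | hrefl
  · have : b = fun i => a (i + ρ 0) := by
      ext i
      rw [hb, hrot, add_comm]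
    rw [this]
    exact shiftRevEquiv_add a _
  · have : b = fun i => reverseSeq a (i + (Fin.last n - ρ 0)) := by
      ext i
      rw [hb, hrefl, reverseSeq, ← Fin.last_sub]
      congr 1
      abel
    rw [this]
    exact Relation.EqvGen.trans _ _ _ (Relation.EqvGen.rel _ _ (Or.inr rfl))
      (shiftRevEquiv_add _ _)

/-! ### Members of `ForbRow` among the obstructions -/

theorem cycleMatrix_mem_forbRow {k : ℕ} (hk : 3 ≤ k) {a : Fin k → Bool} (ha : a ∈ braceletSet k) :
    (⟨k, k + 1, cycleMatrix k a⟩ : BinMatrix) ∈ ForbRow :=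
  Or.inl ⟨k, hk, a, ha, rfl⟩

/-- On three rows only the parity of the number of complemented rows matters. -/
theorem cycleMatrix_three_same (a : Fin 3 → Bool) : ∃ b ∈ braceletSet 3,
    BinMatrix.SameConfiguration ⟨3, 4, cycleMatrix 3 a⟩ ⟨3, 4, cycleMatrix 3 b⟩ := by
  have h0 : (fun _ => false) ∈ braceletSet 3 := by simp [braceletSet]
  have h1 : (fun _ => true) ∈ braceletSet 3 := by simp [braceletSet]
  obtain ⟨x, y, z, rfl⟩ : ∃ x y z, a = ![x, y, z] :=
    ⟨a 0, a 1, a 2, by ext i; fin_cases i <;> rfl⟩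
  cases x <;> cases y <;> cases z
  · exact ⟨_, h0, sameConfiguration_of_injective id ![0, 1, 2, 3] (by decide) (by decide)
      (by decide)⟩
  · exact ⟨_, h1, sameConfiguration_of_injective id ![2, 3, 0, 1] (by decide) (by decide)
      (by decide)⟩
  · exact ⟨_, h1, sameConfiguration_of_injective id ![3, 2, 1, 0] (by decide) (by decide)
      (by decide)⟩
  · exact ⟨_, h0, sameConfiguration_of_injective id ![1, 0, 3, 2] (by decide) (by decide)
      (by decide)⟩
  · exact ⟨_, h1, sameConfiguration_of_injective id ![1, 0, 3, 2] (by decide) (by decide)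
      (by decide)⟩
  · exact ⟨_, h0, sameConfiguration_of_injective id ![3, 2, 1, 0] (by decide) (by decide)
      (by decide)⟩
  · exact ⟨_, h0, sameConfiguration_of_injective id ![2, 3, 0, 1] (by decide) (by decide)
      (by decide)⟩
  · exact ⟨_, h1, sameConfiguration_of_injective id ![0, 1, 2, 3] (by decide) (by decide)
      (by decide)⟩

theorem exists_braceletSet_same {k : ℕ} (a : Fin k → Bool) : ∃ b ∈ braceletSet k,
    BinMatrix.SameConfiguration ⟨k, k + 1, cycleMatrix k a⟩ ⟨k, k + 1, cycleMatrix k b⟩ := by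
  by_cases hk : k = 3
  · subst hk
    exact cycleMatrix_three_same a
  · obtain ⟨b, hab, hb⟩ := exists_bracelet a
    exact ⟨b, by simpa [braceletSet, hk] using hb, cycleMatrix_same_of_shiftRevEquiv hab⟩

/-- Complementing some of the first three rows of `M_IV` gives, depending on their number, the
configuration `M_IV`, `M_V*`, the complement of `M_V*` or the complement of `M_IV`. -/
theorem exists_forbRow_same_tuckerIV (x y z : Bool) : ∃ F ∈ ForbRow,
    BinMatrix.SameConfiguration ⟨4, 6, complementRows ![x, y, z, false] tuckerIV⟩ F := by
  have m1 : (⟨4, 6, tuckerIV⟩ : BinMatrix) ∈ ForbRow := Or.inr (Or.inl rfl)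
  have m2 : (⟨4, 6, complementMatrix tuckerIV⟩ : BinMatrix) ∈ ForbRow :=
    Or.inr (Or.inr (Or.inl rfl))
  have m3 : (⟨4, 6, starMatrix tuckerV⟩ : BinMatrix) ∈ ForbRow :=
    Or.inr (Or.inr (Or.inr (Or.inl rfl)))
  have m4 : (⟨4, 6, complementMatrix (starMatrix tuckerV)⟩ : BinMatrix) ∈ ForbRow :=
    Or.inr (Or.inr (Or.inr (Or.inr rfl)))
  cases x <;> cases y <;> cases z
  · exact ⟨_, m1, sameConfiguration_of_injective ![0, 1, 2, 3] ![0, 1, 2, 3, 4, 5] (by decide)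
      (by decide) (by decide)⟩
  · exact ⟨_, m3, sameConfiguration_of_injective ![0, 2, 1, 3] ![1, 0, 2, 3, 5, 4] (by decide)
      (by decide) (by decide)⟩
  · exact ⟨_, m3, sameConfiguration_of_injective ![0, 1, 2, 3] ![1, 0, 4, 5, 3, 2] (by decide)
      (by decide) (by decide)⟩
  · exact ⟨_, m4, sameConfiguration_of_injective ![1, 0, 2, 3] ![2, 3, 5, 4, 0, 1] (by decide)
      (by decide) (by decide)⟩
  · exact ⟨_, m3, sameConfiguration_of_injective ![1, 0, 2, 3] ![3, 2, 4, 5, 1, 0] (by decide)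
      (by decide) (by decide)⟩
  · exact ⟨_, m4, sameConfiguration_of_injective ![0, 1, 2, 3] ![0, 1, 5, 4, 2, 3] (by decide)
      (by decide) (by decide)⟩
  · exact ⟨_, m4, sameConfiguration_of_injective ![0, 2, 1, 3] ![0, 1, 3, 2, 4, 5] (by decide)
      (by decide) (by decide)⟩
  · exact ⟨_, m2, sameConfiguration_of_injective ![0, 1, 2, 3] ![1, 0, 3, 2, 5, 4] (by decide)
      (by decide) (by decide)⟩

theorem exists_contains_of_hasTransversal {M : BinMatrix} (h : HasTransversal (Set.range M.mat)) :
    ∃ x y z, M.ContainsConfiguration ⟨4, 6, complementRows ![x, y, z, false] tuckerIV⟩ := by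
  obtain ⟨a₁, a₂, b₁, b₂, c₁, c₂, A, B, C, T, ⟨ia, rfl⟩, ⟨ib, rfl⟩, ⟨ic, rfl⟩, ⟨it, rfl⟩, h⟩ := h
  -- the two sides may be exchanged
  have key : ∀ {a₁ a₂ b₁ b₂ c₁ c₂ : Fin M.numCols}, IsTransversalOn a₁ a₂ b₁ b₂ c₁ c₂
      (M.mat ia) (M.mat ib) (M.mat ic) (M.mat it) → M.mat it a₁ = false →
      ∃ x y z, M.ContainsConfiguration ⟨4, 6, complementRows ![x, y, z, false] tuckerIV⟩ := by
    intro a₁ a₂ b₁ b₂ c₁ c₂ h hT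
    obtain ⟨⟨x1, x2, x3, x4, x5⟩, ⟨y1, y2, y3, y4, y5⟩, ⟨z1, z2, z3, z4, z5⟩,
      t1, t2, t3, t4, t5⟩ := h
    rw [← Bool.eq_not] at x5 y5 z5
    rw [hT] at t1 t2 t5
    have hT₂ : M.mat it a₂ = true := by simpa using t5.symm
    rw [hT₂] at t3 t4
    generalize hx : M.mat ia b₁ = x at *
    generalize hy : M.mat ib c₁ = y at *
    generalize hz : M.mat ic a₁ = z at *
    refine ⟨x, y, z, containsConfiguration_of_entries ?_ ?_ ![ia, ib, ic, it]
      ![a₁, a₂, b₁, b₂, c₁, c₂] ?_⟩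
    · have h : ∀ i i', (∀ j, complementRows ![x, y, z, false] tuckerIV i j ==
          complementRows ![x, y, z, false] tuckerIV i' j) → i = i' := by
        clear * -
        cases x <;> cases y <;> cases z <;> decide
      exact fun i i' e => h i i' fun j => beq_iff_eq.2 (e j)
    · clear * -
      cases x <;> cases y <;> cases z <;> decide
    · rw [x5] at x1
      rw [y5] at y1
      rw [z5] at z1
      intro i j
      fin_cases i <;> fin_cases j <;> simp [complementRows, tuckerIV, hT, hT₂, hx, hy, hz, ← x1,
        ← x2, x3, x4, x5, ← y1, ← y2, y3, y4, y5, ← z1, ← z2, z3, z4, z5, t1, t2, t3, t4]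
  cases hT : M.mat it a₁
  · exact key h hT
  · refine key h.flip ?_
    have := h.transversal.2.2.2.2
    rw [hT] at this
    simpa using this.symm

/-- A matrix whose rows contain an obstruction contains a member of `ForbRow`. -/
theorem exists_forbRow_of_hasObstruction {M : BinMatrix}
    (h : HasObstruction (Set.range M.mat)) : ∃ F ∈ ForbRow, M.ContainsConfiguration F := by
  rcases h with h | h
  · obtain ⟨k, hk, a, ha⟩ := exists_cycleMatrix_of_hasCycle h
    obtain ⟨b, hb, hab⟩ := exists_braceletSet_same a
    exact ⟨_, cycleMatrix_mem_forbRow hk hb, ha.trans_same hab⟩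
  · obtain ⟨x, y, z, h⟩ := exists_contains_of_hasTransversal h
    obtain ⟨F, hF, hsame⟩ := exists_forbRow_same_tuckerIV x y z
    exact ⟨F, hF, h.trans_same hsame⟩

/-! ### Minimality of the members of `ForbRow` -/

theorem BinMatrix.IsSubmatrix.eq_of_surjective {N M : BinMatrix}
    {f : Fin N.numRows ↪o Fin M.numRows} {g : Fin N.numCols ↪o Fin M.numCols}
    (h : N.mat = M.mat.submatrix f g) (hf : Function.Surjective f)
    (hg : Function.Surjective g) : N = M := by
  obtain ⟨r, c, A⟩ := N
  obtain ⟨r', c', B⟩ := M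
  dsimp only at f g h hf hg
  obtain rfl : r = r' := Fin.equiv_iff_eq.1 ⟨Equiv.ofBijective f ⟨f.injective, hf⟩⟩
  obtain rfl : c = c' := Fin.equiv_iff_eq.1 ⟨Equiv.ofBijective g ⟨g.injective, hg⟩⟩
  have hf' : (f : Fin r → Fin r) = id :=
    congrArg DFunLike.coe (Subsingleton.elim (RelIso.ofSurjective f hf) (OrderIso.refl _))
  have hg' : (g : Fin c → Fin c) = id :=
    congrArg DFunLike.coe (Subsingleton.elim (RelIso.ofSurjective g hg) (OrderIso.refl _))
  rw [hf', hg'] at h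
  rw [h]
  rfl

/-- A matrix with an obstruction is minimal forbidden if the remainder has a circular arrangement
whenever a row or a column is deleted. This depends on its rows up to complementation only. -/
theorem isMinimalForbidden_of_arrangements {r c : ℕ} {A B : Matrix (Fin r) (Fin c) Bool}
    (hAB : ∀ i x y, B i x = B i y ↔ A i x = A i y) (hobs : HasObstruction (Set.range A))
    (hrow : ∀ i₀, ∃ f : Fin c → ℤ, Function.Injective f ∧
      ∀ i ≠ i₀, IsArcOn f Finset.univ (A i))
    (hcol : ∀ j₀, ∃ f : Fin c → ℤ, Function.Injective f ∧
      ∀ i, IsArcOn f (Finset.univ.erase j₀) (A i)) :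
    BinMatrix.IsMinimalForbidden ⟨r, c, B⟩ := by
  constructor
  · rw [hasCircularOnes_iff_not_hasObstruction, not_not]
    refine hobs.of_map id ?_
    rintro _ ⟨i, rfl⟩
    exact ⟨_, ⟨i, rfl⟩, fun x y => hAB i x y⟩
  · rintro ⟨r', c', N⟩ ⟨f, g, hN⟩ hne
    rw [hasCircularOnes_iff]
    dsimp only at f g hN ⊢
    have hcomp : ∀ (h : Fin c → ℤ) (i : Fin r') (Z : Finset (Fin c)), (∀ j, g j ∈ Z) →
        IsArcOn h Z (A (f i)) → IsArcOn (h ∘ g) Finset.univ (N i) := by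
      intro h i Z hZ harc x _ y _ z _ t _ hxy hyz hzt ⟨e1, e2, e3⟩
      have hNB : ∀ j, N i j = B (f i) (g j) := fun j => by rw [hN]; rfl
      rw [hNB, hNB, hAB] at e1 e2
      rw [hNB, hNB, Ne, hAB] at e3
      exact harc _ (hZ x) _ (hZ y) _ (hZ z) _ (hZ t) hxy hyz hzt ⟨e1, e2, e3⟩
    by_cases hf : Function.Surjective f
    · by_cases hg : Function.Surjective g
      · exact absurd (BinMatrix.IsSubmatrix.eq_of_surjective (N := ⟨r', c', N⟩)
          (M := ⟨r, c, B⟩) hN hf hg) hne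
      · obtain ⟨j₀, hj₀⟩ := not_forall.1 hg
        obtain ⟨h, hh, harc⟩ := hcol j₀
        exact ⟨h ∘ g, hh.comp g.injective, fun i => hcomp h i _ (fun j =>
          Finset.mem_erase.2 ⟨fun e => hj₀ ⟨j, e⟩, Finset.mem_univ _⟩) (harc _)⟩
    · obtain ⟨i₀, hi₀⟩ := not_forall.1 hf
      obtain ⟨h, hh, harc⟩ := hrow i₀
      exact ⟨h ∘ g, hh.comp g.injective, fun i => hcomp h i _ (fun j => Finset.mem_univ _)
        (harc _ fun e => hi₀ ⟨i, e⟩)⟩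

/-- A row one of whose sides is an interval is an arc. -/
theorem isArcOn_of_interval {X : Type*} {f : X → ℤ} {Y : Finset X} {C : X → Bool} (v : Bool)
    (lo hi : ℤ) (h : ∀ x ∈ Y, C x = v ↔ lo ≤ f x ∧ f x ≤ hi) : IsArcOn f Y C := by
  intro x hx y hy z hz t ht hxy hyz hzt ⟨e1, e2, e3⟩
  have kx := h x hx
  have ky := h y hy
  have kz := h z hz
  have kt := h t ht
  rw [← e1] at kz
  rw [← e2] at kt
  by_cases hv : C x = v
  · have : C y = v := ky.2 ⟨by have := (kx.1 hv).1; omega, by have := (kz.1 hv).2; omega⟩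
    exact e3 (hv.trans this.symm)
  · have hy : C y = v := by
      revert hv e3
      cases C x <;> cases C y <;> cases v <;> simp
    exact hv (kz.2 ⟨by have := (ky.1 hy).1; omega, by have := (kt.1 hy).2; omega⟩)

/-- Without row `i₀` the cycle is a path, which is listed from `i₀ + 1` to `i₀`. -/
theorem exists_arrangement_cycleMatrix_row {k : ℕ} (a : Fin k → Bool) (i₀ : Fin k) :
    ∃ f : Fin (k + 1) → ℤ, Function.Injective f ∧
      ∀ i ≠ i₀, IsArcOn f Finset.univ (cycleMatrix k a i) := by
  refine ⟨fun j => if (j : ℕ) = k then 0 else if (j : ℕ) ≤ i₀ then j + k + 1 else j + 1, ?_, ?_⟩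
  · intro x y hxy
    have hx := x.2
    have hy := y.2
    ext
    dsimp only at hxy
    split_ifs at hxy <;> omega
  · intro i hi
    have hi' : (i : ℕ) ≠ i₀ := fun e => hi (Fin.ext e)
    have hik := i.2
    have hi₀ := i₀.2
    refine isArcOn_of_interval (!a i) (if (i : ℕ) ≤ i₀ then i + k + 1 else i + 1)
      (if (i : ℕ) ≤ i₀ then i + k + 2 else i + 2) fun j _ => ?_
    have hj := j.2
    rw [cycleMatrix_eq_iff]
    split_ifs <;> omega

theorem isMinimalForbidden_cycleMatrix {k : ℕ} (hk : 3 ≤ k) (a : Fin k → Bool) :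
    BinMatrix.IsMinimalForbidden ⟨k, k + 1, cycleMatrix k a⟩ := by
  refine isMinimalForbidden_of_arrangements (fun _ _ _ => Iff.rfl) (hasObstruction_cycleMatrix hk a)
    (exists_arrangement_cycleMatrix_row a) fun j₀ => ?_
  by_cases hj₀ : (j₀ : ℕ) < k
  · -- without column `j₀` the row `j₀` becomes trivial
    obtain ⟨f, hf, harc⟩ := exists_arrangement_cycleMatrix_row a ⟨j₀, hj₀⟩
    refine ⟨f, hf, fun i => ?_⟩
    by_cases hi : i = ⟨j₀, hj₀⟩
    · refine isArcOn_of_trivial _ _ _ (!a i) fun x hx y hy h1 h2 => ?_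
      have hx' : (x : ℕ) ≠ j₀ := fun e => (Finset.mem_erase.1 hx).1 (Fin.ext e)
      have hy' : (y : ℕ) ≠ j₀ := fun e => (Finset.mem_erase.1 hy).1 (Fin.ext e)
      rw [cycleMatrix_eq_iff, hi] at h1 h2
      dsimp only at h1 h2
      ext
      omega
    · intro x _ y _ z _ t _
      exact harc i hi x (Finset.mem_univ _) y (Finset.mem_univ _) z (Finset.mem_univ _) t
        (Finset.mem_univ _)
  · -- without the last column the cycle is arranged as it stands
    refine ⟨fun j => j, fun x y hxy => by simpa [Fin.val_inj] using hxy, fun i => ?_⟩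
    have hi := i.2
    by_cases hik : (i : ℕ) + 1 = k
    · refine isArcOn_of_interval (a i) 1 (k - 2) fun j hj => ?_
      have hj' : (j : ℕ) ≠ j₀ := fun e => (Finset.mem_erase.1 hj).1 (Fin.ext e)
      have hj2 := j.2
      have hj₀2 := j₀.2
      have h := cycleMatrix_eq_iff a i j
      rw [if_pos hik] at h
      have h2 : cycleMatrix k a i j = a i ↔ ¬ (cycleMatrix k a i j = !a i) := by simp
      rw [h2, h]
      omega
    · refine isArcOn_of_interval (!a i) i (i + 1) fun j hj => ?_
      rw [cycleMatrix_eq_iff, if_neg hik]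
      omega

/-- The criterion for matrices with six columns, where `P i₀` and `Q j₀` list the positions of the
columns after the deletion of row `i₀` or column `j₀`. -/
theorem isMinimalForbidden_of_positions {A B : Matrix (Fin 4) (Fin 6) Bool}
    (hAB : ∀ i x y, B i x = B i y ↔ A i x = A i y) (hobs : HasObstruction (Set.range A))
    (P : Fin 4 → Fin 6 → Fin 6) (Q : Fin 6 → Fin 6 → Fin 6)
    (hP : ∀ i₀, Function.Injective (P i₀)) (hQ : ∀ j₀, Function.Injective (Q j₀))
    (hrow : ∀ i₀, ∀ i ≠ i₀, ∃ (v : Bool) (lo hi : Fin 6), ∀ x,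
      (A i x == v) = decide (lo ≤ P i₀ x ∧ P i₀ x ≤ hi))
    (hcol : ∀ j₀ i, ∃ (v : Bool) (lo hi : Fin 6), ∀ x ≠ j₀,
      (A i x == v) = decide (lo ≤ Q j₀ x ∧ Q j₀ x ≤ hi)) :
    BinMatrix.IsMinimalForbidden ⟨4, 6, B⟩ := by
  have hcast : ∀ p : Fin 6 → Fin 6, Function.Injective p →
      Function.Injective (fun x => ((p x : ℕ) : ℤ)) := fun p hp x y hxy =>
    hp (Fin.ext (Int.ofNat_inj.1 hxy))
  refine isMinimalForbidden_of_arrangements hAB hobs (fun i₀ => ⟨_, hcast _ (hP i₀), ?_⟩)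
    fun j₀ => ⟨_, hcast _ (hQ j₀), ?_⟩
  · intro i hi
    obtain ⟨v, lo, hi, h⟩ := hrow i₀ i hi
    refine isArcOn_of_interval v (lo : ℕ) (hi : ℕ) fun x _ => ?_
    rw [← beq_iff_eq, h, decide_eq_true_eq, Fin.le_def, Fin.le_def]
    exact and_congr Int.ofNat_le.symm Int.ofNat_le.symm
  · intro i
    obtain ⟨v, lo, hi, h⟩ := hcol j₀ i
    refine isArcOn_of_interval v (lo : ℕ) (hi : ℕ) fun x hx => ?_
    rw [← beq_iff_eq, h x (Finset.mem_erase.1 hx).1, decide_eq_true_eq, Fin.le_def, Fin.le_def]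
    exact and_congr Int.ofNat_le.symm Int.ofNat_le.symm

theorem hasObstruction_tuckerIV : HasObstruction (Set.range tuckerIV) :=
  Or.inr ⟨0, 1, 2, 3, 4, 5, tuckerIV 0, tuckerIV 1, tuckerIV 2, tuckerIV 3, ⟨_, rfl⟩, ⟨_, rfl⟩,
    ⟨_, rfl⟩, ⟨_, rfl⟩, by unfold CutsPair; decide, by unfold CutsPair; decide,
    by unfold CutsPair; decide, by unfold CutsTriple; decide⟩

theorem hasObstruction_starMatrix_tuckerV : HasObstruction (Set.range (starMatrix tuckerV)) :=
  Or.inr ⟨1, 0, 2, 3, 5, 4, starMatrix tuckerV 0, starMatrix tuckerV 2, starMatrix tuckerV 1,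
    starMatrix tuckerV 3, ⟨_, rfl⟩, ⟨_, rfl⟩, ⟨_, rfl⟩, ⟨_, rfl⟩, by unfold CutsPair; decide,
    by unfold CutsPair; decide, by unfold CutsPair; decide, by unfold CutsTriple; decide⟩

theorem isMinimalForbidden_of_tuckerIV {B : Matrix (Fin 4) (Fin 6) Bool}
    (hB : ∀ i x y, B i x = B i y ↔ tuckerIV i x = tuckerIV i y) :
    BinMatrix.IsMinimalForbidden ⟨4, 6, B⟩ :=
  isMinimalForbidden_of_positions hB hasObstruction_tuckerIV
    ![![5, 2, 0, 1, 4, 3], ![0, 1, 5, 2, 4, 3], ![0, 1, 4, 3, 5, 2], ![0, 1, 2, 3, 4, 5]]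
    ![![5, 2, 0, 1, 4, 3], ![5, 2, 0, 1, 4, 3], ![0, 1, 5, 2, 4, 3], ![0, 1, 5, 2, 4, 3],
      ![0, 1, 4, 3, 5, 2], ![0, 1, 4, 3, 5, 2]]
    (by decide) (by decide) (by decide) (by decide)

theorem isMinimalForbidden_of_starMatrix_tuckerV {B : Matrix (Fin 4) (Fin 6) Bool}
    (hB : ∀ i x y, B i x = B i y ↔ starMatrix tuckerV i x = starMatrix tuckerV i y) :
    BinMatrix.IsMinimalForbidden ⟨4, 6, B⟩ :=
  isMinimalForbidden_of_positions hB hasObstruction_starMatrix_tuckerV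
    ![![2, 5, 0, 1, 3, 4], ![1, 0, 4, 3, 2, 5], ![1, 0, 5, 2, 3, 4], ![0, 1, 2, 3, 4, 5]]
    ![![2, 5, 0, 1, 3, 4], ![2, 5, 0, 1, 3, 4], ![1, 0, 5, 2, 3, 4], ![1, 0, 5, 2, 3, 4],
      ![1, 0, 4, 3, 2, 5], ![1, 0, 4, 3, 2, 5]]
    (by decide) (by decide) (by decide) (by decide)

theorem isMinimalForbidden_of_mem_forbRow {F : BinMatrix} (hF : F ∈ ForbRow) :
    F.IsMinimalForbidden := by
  rcases hF with ⟨k, hk, a, -, rfl⟩ | rfl | rfl | rfl | rfl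
  · exact isMinimalForbidden_cycleMatrix hk a
  · exact isMinimalForbidden_of_tuckerIV fun _ _ _ => Iff.rfl
  · exact isMinimalForbidden_of_tuckerIV fun i x y => by simp [complementMatrix]
  · exact isMinimalForbidden_of_starMatrix_tuckerV fun _ _ _ => Iff.rfl
  · exact isMinimalForbidden_of_starMatrix_tuckerV fun i x y => by simp [complementMatrix]

/-! ### No two members of `ForbRow` have the same configuration -/

theorem BinMatrix.SameConfiguration.sum_eq {M N : BinMatrix} (h : M.SameConfiguration N) :
    ∑ i, ∑ j, (M.mat i j).toNat = ∑ i, ∑ j, (N.mat i j).toNat := by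
  obtain ⟨ρ, τ, h⟩ := h
  rw [h, ← Equiv.sum_comp ρ]
  refine Finset.sum_congr rfl fun i _ => ?_
  rw [← Equiv.sum_comp τ]
  rfl

theorem IsBracelet.eq_of_shiftRevEquiv {k : ℕ} {a b : Fin k → Bool} (ha : IsBracelet a)
    (hb : IsBracelet b) (h : ShiftRevEquiv a b) : a = b :=
  toLex.injective (le_antisymm (ha b h) (hb a (Relation.EqvGen.symm _ _ h)))

theorem eq_of_cycleMatrix_same {k : ℕ} (hk : 3 ≤ k) {a b : Fin k → Bool} (ha : a ∈ braceletSet k)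
    (hb : b ∈ braceletSet k)
    (h : BinMatrix.SameConfiguration ⟨k, k + 1, cycleMatrix k a⟩ ⟨k, k + 1, cycleMatrix k b⟩) :
    a = b := by
  by_cases hk3 : k = 3
  · subst hk3
    -- only one of the two matrices has a zero column
    have key : ¬ BinMatrix.SameConfiguration ⟨3, 4, cycleMatrix 3 fun _ => true⟩
        ⟨3, 4, cycleMatrix 3 fun _ => false⟩ := by
      rintro ⟨ρ, τ, h⟩
      change Fin 3 ≃ Fin 3 at ρ
      change Fin 4 ≃ Fin 4 at τ
      have hcol : ∀ j, ∃ i, cycleMatrix 3 (fun _ => true) i j = true := by decide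
      obtain ⟨i, hi⟩ := hcol (τ 3)
      have h2 : cycleMatrix 3 (fun _ => false) (ρ.symm i) 3 =
          cycleMatrix 3 (fun _ => true) (ρ (ρ.symm i)) (τ 3) :=
        congrFun (congrFun h (ρ.symm i)) 3
      rw [Equiv.apply_symm_apply, hi] at h2
      have hzero : ∀ i, cycleMatrix 3 (fun _ => false) i 3 = false := by decide
      rw [hzero] at h2
      exact Bool.false_ne_true h2
    simp only [braceletSet, if_true, Set.mem_ofPred_eq] at ha hb
    rcases ha with rfl | rfl <;> rcases hb with rfl | rfl
    · rfl
    · exact absurd h.symm key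
    · exact absurd h key
    · rfl
  · simp only [braceletSet, hk3, if_false, Set.mem_ofPred_eq] at ha hb
    exact ha.eq_of_shiftRevEquiv hb (shiftRevEquiv_of_cycleMatrix_same (by omega) h)

theorem eq_of_sameConfiguration {F G : BinMatrix} (hF : F ∈ ForbRow) (hG : G ∈ ForbRow)
    (h : F.SameConfiguration G) : F = G := by
  have hrows : F.numRows = G.numRows := (Fin.equiv_iff_eq.1 ⟨h.choose⟩).symm
  have hcols : F.numCols = G.numCols := (Fin.equiv_iff_eq.1 ⟨h.choose_spec.choose⟩).symm
  have hsum := h.sum_eq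
  rcases hF with ⟨k, hk, a, ha, rfl⟩ | hF
  · rcases hG with ⟨l, hl, b, hb, rfl⟩ | hG
    · dsimp only at hrows
      subst hrows
      rw [eq_of_cycleMatrix_same hk ha hb h]
    · rcases hG with rfl | rfl | rfl | rfl <;> dsimp only at hrows hcols <;> omega
  · rcases hG with ⟨l, hl, b, hb, rfl⟩ | hG
    · rcases hF with rfl | rfl | rfl | rfl <;> dsimp only at hrows hcols <;> omega
    · -- the four matrices have 9, 15, 11 and 13 ones
      rcases hF with rfl | rfl | rfl | rfl <;> rcases hG with rfl | rfl | rfl | rfl <;>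
        first
        | rfl
        | exact absurd hsum (by decide)

theorem hasCircularOnes_iff_forall_forbRow (M : BinMatrix) :
    M.HasCircularOnes ↔ ∀ F ∈ ForbRow, ¬ M.ContainsConfiguration F := by
  constructor
  · exact fun hM F hF hMF => (isMinimalForbidden_of_mem_forbRow hF).1 (hM.of_contains hMF)
  · intro h
    rw [hasCircularOnes_iff_not_hasObstruction]
    intro hobs
    obtain ⟨F, hF, hMF⟩ := exists_forbRow_of_hasObstruction hobs
    exact h F hF hMF

theorem mainTheorem3 :
    (∀ M : BinMatrix, M.HasCircularOnes ↔ ∀ F ∈ ForbRow, ¬ M.ContainsConfiguration F) ∧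
    Minimal CharacterizesCircularOnes ForbRow ∧
    (∀ F ∈ ForbRow, F.IsMinimalForbidden) := by
  refine ⟨hasCircularOnes_iff_forall_forbRow, ⟨hasCircularOnes_iff_forall_forbRow, ?_⟩,
    fun F hF => isMinimalForbidden_of_mem_forbRow hF⟩
  -- a member of `ForbRow` contains no other member
  intro S hS hSF F hF
  obtain ⟨hFnot, hFmin⟩ := isMinimalForbidden_of_mem_forbRow hF
  obtain ⟨G, hG, N, hNF, hNG⟩ : ∃ G ∈ S, F.ContainsConfiguration G := by
    by_contra hcon
    push Not at hcon
    exact hFnot ((hS F).2 hcon)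
  have hN : N = F := by
    by_contra hne
    refine (isMinimalForbidden_of_mem_forbRow (hSF hG)).1 ((hFmin N hNF hne).of_contains ?_)
    obtain ⟨ρ, τ, h⟩ := hNG
    exact (containsConfiguration_iff _ _).2 ⟨ρ, τ, ρ.injective, τ.injective, fun i j => by
      rw [h]; rfl⟩
  subst hN
  rwa [eq_of_sameConfiguration hF (hSF hG) hNG]
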